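/- Definitions. An orthomodular poset (OMP) is a bounded poset $L$ with an order-reversing involution $x\mapsto x'$ such that $x\vee x'=1$, the join $x\vee y$ exists whenever $x\perp y$ (i.e. $x\le y'$), and $x\le y$ implies $y=x\vee(y\wedge x')$. A block of a finite OMP is a maximal set of pairwise orthogonal atoms. A finite OMP is $(3,3)$-homogeneous if every atom lies in exactly 3 blocks and every block has exactly 3 elements. A state is a map $s:L\to[0,1]$ with $s(1)=1$ and $s(x\vee y)=s(x)+s(y)$ whenever $x\perp y$; $S(L)$ is the convex set of all states, and its extreme points are the pure states. Theorem 2.2. For every $k\in\{1,2,3,4,5,6,7,10,11\}$ there exists a finite $(3,3)$-homogeneous OMP with at most 19 atoms that has exactly $k$ pure states. More precisely, for each such $k$ there is a finite $(3,3)$-homogeneous OMP $H_k(m)$ with exactly $k$ pure states, whose atoms can be enumerated without repetition as $1,\dots,m$ so that its blocks are exactly the sets $\{i,j,n\}$, written $i$-$j$-$n$, listed below, and whose state space is as described. For $k\neq1$, the listed coordinates map $S(H_k(m))$ bijectively onto the given polytope, and map the set of pure states onto the given set of points. For $k\ne 2$ the list contains, besides the blocks displayed for that $k$, the seven blocks 1-2-3,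 1-4-5, 1-6-7, 2-8-9, 2-10-11, 3-12-13, 3-14-15. 1. $H_1(19)$: 4-8-12, 4-10-14, 5-9-16, 5-11-17, 6-8-15, 6-13-16, 7-9-18, 7-14-17, 10-16-19, 11-13-18, 12-17-19, 15-18-19. There is exactly one state, and $s(i)=\frac13$ for all $i=1,\dots,19$. 2. $H_2(17)$ (full list): 1-2-8, 2-3-9, 3-4-10, 4-5-11, 5-6-12, 6-7-13, 1-7-14, 1-5-15, 8-10-13, 8-11-17, 2-12-16, 9-11-14, 9-13-15, 3-6-17, 10-12-14, 4-7-16, 15-16-17. Coordinate $x=s(1)$; $0\le x\le\frac23$; pure states $x=0$, $x=\frac23$. 3. $H_3(18)$: 4-8-12, 4-14-16, 5-10-13, 5-17-18, 6-11-12, 6-16-18, 7-9-17, 7-10-15, 8-15-18, 9-13-16, 11-14-17. Coordinates $(x,y)=(s(17),s(18))$; $0\le x\le1$, $0\le y\le1$, $x+y\le1$; pure states $(0,0),(1,0),(0,1)$. 4. $H_4(19)$: 4-8-12, 4-10-14, 5-9-13, 5-11-16, 6-8-15, 6-11-17, 7-9-18, 7-10-19, 12-16-18, 13-17-19, 14-17-18,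 15-16-19. Coordinates $(x,y)=(s(6),s(8))$; $0\le x\le\frac23$, $\frac16\le y\le\frac12$, $\frac12\le x+y\le\frac56$; pure states $(0,\frac12),(\frac13,\frac16),(\frac23,\frac16),(\frac13,\frac12)$. 5. $H_5(19)$: 4-8-12, 4-10-14, 5-9-15, 5-11-13, 6-13-16, 6-15-17, 7-11-18, 7-12-19, 8-17-18, 9-16-19, 10-17-19, 14-16-18. Coordinates $(x,y)=(s(15),s(19))$; $0\le x\le\frac23$, $0\le y\le\frac23$, $x-y\le\frac13$; pure states $(0,0),(0,\frac23),(\frac13,0),(\frac23,\frac13),(\frac23,\frac23)$. 6. $H_6(19)$: 4-8-12, 4-10-14, 5-9-13, 5-11-16, 6-9-15, 6-11-17, 7-10-18, 7-13-19, 8-16-19, 12-17-18, 14-17-19, 15-16-18. Coordinates $(x,y)=(s(2),s(10))$; $0\le x\le\frac23$, $\frac16\le y\le\frac12$, $y+x\le1$, $y-x\le\frac13$; pure states $(0,\frac16),(0,\frac13),(\frac16,\frac12),(\frac12,\frac12),(\frac23,\frac13),(\frac23,\frac16)$. 7. $H_7(18)$: 4-8-12, 4-10-14, 5-11-15, 5-16-17,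 6-8-18, 6-10-16, 7-9-15, 7-12-17, 9-13-16, 11-13-18, 14-17-18. Coordinates $(x,y,z)=(s(1),s(3),s(18))$; $0\le x\le1$, $0\le y\le1$, $0\le z\le\frac12$, $x+y\le1$, $x+z\le1$, $y+z\le1$; pure states $(0,0,0),(0,1,0),(1,0,0),(0,0,\frac12),(0,\frac12,\frac12),(\frac12,0,\frac12),(\frac12,\frac12,\frac12)$. 8. $H_{10}(18)$: 4-8-12, 4-10-14, 5-9-16, 5-11-17, 6-9-13, 6-11-15, 7-12-16, 7-14-17, 8-15-18, 10-16-18, 13-17-18. Coordinates $(x,y,z,w)=(s(1),s(2),s(8),s(10))$; $x,y,z,w\ge0$, $x+y\le1$, $y+z\le1$, $y+w\le1$, $z+w\le1$, $z\le x+y$, $w\le x+y$; pure states $(0,0,0,0),(0,1,0,0),(1,0,0,0),(1,0,1,0),(1,0,0,1),(0,\frac12,\frac12,0),(0,\frac12,0,\frac12),(0,\frac12,\frac12,\frac12),(\frac12,0,\frac12,\frac12),(\frac12,\frac12,\frac12,\frac12)$. 9. $H_{11}(19)$: 4-8-12, 4-10-14, 5-9-15, 5-11-13, 6-8-16, 6-10-17,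 7-13-19, 7-15-18, 9-17-19, 11-16-18, 12-17-18, 14-16-19. Coordinates $(x,y,z)=(s(10),s(15),s(19))$; $0\le x\le\frac23$, $0\le y\le\frac23$, $0\le z\le\frac23$, $x+y\ge\frac13$, $z\ge x-\frac13$, $y+z\le1$; pure states $(\frac13,0,0),(0,\frac13,0),(0,\frac23,0),(\frac13,\frac23,0),(\frac23,\frac23,\frac13),(\frac23,0,\frac13),(0,\frac23,\frac13),(\frac13,0,\frac23),(\frac23,0,\frac23),(\frac23,\frac13,\frac23),(0,\frac13,\frac23)$. -/

import Mathlib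

/-- An orthomodular poset (OMP): a bounded poset with an order-reversing involution `ᶜ` which is an
orthocomplementation, in which any two orthogonal elements (`x ≤ yᶜ`) have a join, and which satisfies
the orthomodular law `x ≤ y → y = x ∨ (y ∧ xᶜ)`. Joins are expressed through `IsLUB`; the meet
`y ∧ xᶜ` is `(x ∨ yᶜ)ᶜ`, where the join exists because `x` and `yᶜ` are orthogonal. -/
class OrthomodularPoset (L : Type*) extends PartialOrder L, BoundedOrder L, Compl L where
  compl_compl' : ∀ x : L, xᶜᶜ = x
  compl_antitone' : ∀ x y : L, x ≤ y → yᶜ ≤ xᶜ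
  sup_compl' : ∀ x : L, IsLUB {x, xᶜ} ⊤
  exists_sup' : ∀ x y : L, x ≤ yᶜ → ∃ z, IsLUB {x, y} z
  orthomodular' : ∀ x y w : L, x ≤ y → IsLUB {x, yᶜ} w → IsLUB {x, wᶜ} y

namespace OrthomodularPoset

/-- The set of atoms. -/
def atoms (L : Type*) [OrthomodularPoset L] : Set L := {x | IsAtom x}

/-- A set of pairwise orthogonal atoms. -/
def IsOrthogonalSetOfAtoms {L : Type*} [OrthomodularPoset L] (A : Set L) : Prop :=
  A ⊆ atoms L ∧ ∀ x ∈ A, ∀ y ∈ A, x ≠ y → x ≤ yᶜ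

/-- A block: a maximal orthogonal set of atoms. -/
def IsBlock {L : Type*} [OrthomodularPoset L] (A : Set L) : Prop :=
  Maximal (fun A : Set L => IsOrthogonalSetOfAtoms A) A

/-- `(n, m)`-homogeneity: every atom is in exactly `n` blocks, every block has exactly `m` elements. -/
def IsHomogeneous (n m : ℕ) (L : Type*) [OrthomodularPoset L] : Prop :=
  (∀ x ∈ atoms L, {A : Set L | IsBlock A ∧ x ∈ A}.encard = n) ∧
    ∀ A : Set L, IsBlock A → A.encard = m

/-- The convex set of states: `[0,1]`-valued functions, normalized at `⊤` and additive on
orthogonal pairs. -/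
def stateSpace (L : Type*) [OrthomodularPoset L] : Set (L → ℝ) :=
  {s | (∀ x, 0 ≤ s x ∧ s x ≤ 1) ∧ s ⊤ = 1 ∧
    ∀ x y z : L, x ≤ yᶜ → IsLUB {x, y} z → s z = s x + s y}

/-- The pure states: the extreme points of the state space. -/
def pureStates (L : Type*) [OrthomodularPoset L] : Set (L → ℝ) :=
  Set.extremePoints ℝ (stateSpace L)

/-- `a 1, …, a m` is an enumeration without repetitions of the atoms of the finite OMP `L`, and the
blocks of `L` are exactly the sets `{a i | i ∈ b}` with `b` in the list `B`. -/
def HasBlockList {L : Type*} [OrthomodularPoset L] (m : ℕ) (B : Finset (Finset ℕ)) (a : ℕ → L) :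
    Prop :=
  Finite L ∧ Set.BijOn a (Set.Icc 1 m) (atoms L) ∧
    ∀ A : Set L, IsBlock A ↔ ∃ b ∈ B, A = a '' (b : Set ℕ)

/-- Seven blocks that occur in several of the lists below. -/
def commonBlocks : Finset (Finset ℕ) :=
  {{1, 2, 3}, {1, 4, 5}, {1, 6, 7}, {2, 8, 9}, {2, 10, 11},
   {3, 12, 13}, {3, 14, 15}}

/-- The block list with 19 atoms and 1 pure state. -/
def blocks1 : Finset (Finset ℕ) :=
  commonBlocks ∪ {{4, 8, 12}, {4, 10, 14}, {5, 9, 16}, {5, 11, 17}, {6, 8, 15},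
   {6, 13, 16}, {7, 9, 18}, {7, 14, 17}, {10, 16, 19}, {11, 13, 18},
   {12, 17, 19}, {15, 18, 19}}

/-- The block list with 17 atoms and 2 pure states. -/
def blocks2 : Finset (Finset ℕ) :=
  {{1, 2, 8}, {2, 3, 9}, {3, 4, 10}, {4, 5, 11}, {5, 6, 12},
   {6, 7, 13}, {1, 7, 14}, {1, 5, 15}, {8, 10, 13}, {8, 11, 17},
   {2, 12, 16}, {9, 11, 14}, {9, 13, 15}, {3, 6, 17}, {10, 12, 14},
   {4, 7, 16}, {15, 16, 17}}

/-- The block list with 18 atoms and 3 pure states. -/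
def blocks3 : Finset (Finset ℕ) :=
  commonBlocks ∪ {{4, 8, 12}, {4, 14, 16}, {5, 10, 13}, {5, 17, 18}, {6, 11, 12},
   {6, 16, 18}, {7, 9, 17}, {7, 10, 15}, {8, 15, 18}, {9, 13, 16},
   {11, 14, 17}}

/-- The block list with 19 atoms and 4 pure states. -/
def blocks4 : Finset (Finset ℕ) :=
  commonBlocks ∪ {{4, 8, 12}, {4, 10, 14}, {5, 9, 13}, {5, 11, 16}, {6, 8, 15},
   {6, 11, 17}, {7, 9, 18}, {7, 10, 19}, {12, 16, 18}, {13, 17, 19},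
   {14, 17, 18}, {15, 16, 19}}

/-- The block list with 19 atoms and 5 pure states. -/
def blocks5 : Finset (Finset ℕ) :=
  commonBlocks ∪ {{4, 8, 12}, {4, 10, 14}, {5, 9, 15}, {5, 11, 13}, {6, 13, 16},
   {6, 15, 17}, {7, 11, 18}, {7, 12, 19}, {8, 17, 18}, {9, 16, 19},
   {10, 17, 19}, {14, 16, 18}}

/-- The block list with 19 atoms and 6 pure states. -/
def blocks6 : Finset (Finset ℕ) :=
  commonBlocks ∪ {{4, 8, 12}, {4, 10, 14}, {5, 9, 13}, {5, 11, 16}, {6, 9, 15},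
   {6, 11, 17}, {7, 10, 18}, {7, 13, 19}, {8, 16, 19}, {12, 17, 18},
   {14, 17, 19}, {15, 16, 18}}

/-- The block list with 18 atoms and 7 pure states. -/
def blocks7 : Finset (Finset ℕ) :=
  commonBlocks ∪ {{4, 8, 12}, {4, 10, 14}, {5, 11, 15}, {5, 16, 17}, {6, 8, 18},
   {6, 10, 16}, {7, 9, 15}, {7, 12, 17}, {9, 13, 16}, {11, 13, 18},
   {14, 17, 18}}

/-- The block list with 18 atoms and 10 pure states. -/
def blocks10 : Finset (Finset ℕ) :=
  commonBlocks ∪ {{4, 8, 12}, {4, 10, 14}, {5, 9, 16}, {5, 11, 17}, {6, 9, 13},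
   {6, 11, 15}, {7, 12, 16}, {7, 14, 17}, {8, 15, 18}, {10, 16, 18},
   {13, 17, 18}}

/-- The block list with 19 atoms and 11 pure states. -/
def blocks11 : Finset (Finset ℕ) :=
  commonBlocks ∪ {{4, 8, 12}, {4, 10, 14}, {5, 9, 15}, {5, 11, 13}, {6, 8, 16},
   {6, 10, 17}, {7, 13, 19}, {7, 15, 18}, {9, 17, 19}, {11, 16, 18},
   {12, 17, 18}, {14, 16, 19}}

end OrthomodularPoset

/-!
A finite orthomodular poset all of whose blocks have three elements consists of its bounds, its atoms
and its coatoms, and is determined by the orthogonality graph of its atoms. Conversely, a graph in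
which every edge lies in exactly one triangle gives such a poset, its Greechie logic: put an atom below
a coatom iff their vertices are adjacent. Two orthogonal atoms then have the coatom of the third
vertex of their triangle as their join, because by uniqueness of the triangle no other coatom lies
above both of them, and all axioms reduce to this. The blocks are the triangles, so that each
list of blocks in the theorem only has to pass a finite check (`IsConfiguration`).

A state of a Greechie logic is the same thing as a weight, that is, a nonnegative function on the atoms
with sum `1` over every block (`IsConfiguration.bijOn_weights`). For each of the nine lists, the
block equations express all values of a weight affinely through the listed coordinates, and the
nonnegativity of these expressions cuts out the stated polytope (`bijOn_weights_of_section`). As the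
coordinates are linear, they match the pure states with the extreme points of the polytope
(`image_extremePoints_of_bijOn`).

The extreme points of each polytope are determined by `extremePoints_eq_of_subset_convexHull`. No
listed point is the centre of a nontrivial segment in the polytope, by linear arithmetic. Conversely,
the polytope is cut by hyperplanes through listed points into simplices whose vertices are listed
points, and in each simplex the barycentric coordinates are explicit affine functions, so that the
polytope lies in the convex hull of the listed points.
-/

namespace OrthomodularPoset

open Set

/-! ### The Greechie logic of a graph -/

/-- Every edge of `G` lies in exactly one triangle. If `G` is the orthogonality graph of the atoms,
this says that two orthogonal atoms lie in exactly one block, that this block has three elements, and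
that the blocks do not form a loop of order three. -/
def UniqueTriangles {V : Type*} (G : SimpleGraph V) : Prop :=
  ∀ u v, G.Adj u v → ∃! w, G.Adj u w ∧ G.Adj v w

/-- The underlying set of the Greechie logic of a graph `G`: besides the bounds there are an atom and
a coatom for every vertex. The blocks of the logic are going to be the triangles of `G`. -/
inductive GreechieLogic {V : Type*} (G : SimpleGraph V)
  | bot
  | top
  | atom (v : V)
  | coatom (v : V)

namespace GreechieLogic

variable {V : Type*} {G : SimpleGraph V}

/-- The order: an atom lies below a coatom iff their vertices are adjacent. -/
protected def le : GreechieLogic G → GreechieLogic G → Prop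
  | bot, _ => True
  | _, top => True
  | atom u, atom v => u = v
  | coatom u, coatom v => u = v
  | atom u, coatom v => G.Adj u v
  | _, _ => False

/-- The orthocomplementation, which interchanges the atom and the coatom of a vertex. -/
protected def compl : GreechieLogic G → GreechieLogic G
  | bot => top
  | top => bot
  | atom u => coatom u
  | coatom u => atom u

instance : PartialOrder (GreechieLogic G) where
  le := GreechieLogic.le
  le_refl x := by cases x <;> simp [GreechieLogic.le]
  le_trans x y z hxy hyz := by
    cases x <;> cases y <;> cases z <;> simp_all [GreechieLogic.le]
  le_antisymm x y hxy hyx := by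
    cases x <;> cases y <;> simp_all [GreechieLogic.le]

instance : BoundedOrder (GreechieLogic G) where
  top := top
  bot := bot
  le_top x := by cases x <;> trivial
  bot_le x := by cases x <;> trivial

instance : Compl (GreechieLogic G) where
  compl := GreechieLogic.compl

@[simp] theorem bot_eq : (bot : GreechieLogic G) = ⊥ := rfl
@[simp] theorem top_eq : (top : GreechieLogic G) = ⊤ := rfl

@[simp] theorem compl_bot : (⊥ : GreechieLogic G)ᶜ = ⊤ := rfl
@[simp] theorem compl_top : (⊤ : GreechieLogic G)ᶜ = ⊥ := rfl
@[simp] theorem compl_atom (u : V) : (atom u : GreechieLogic G)ᶜ = coatom u := rfl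
@[simp] theorem compl_coatom (u : V) : (coatom u : GreechieLogic G)ᶜ = atom u := rfl

@[simp] theorem atom_le_atom {u v : V} : (atom u : GreechieLogic G) ≤ atom v ↔ u = v := Iff.rfl
@[simp] theorem coatom_le_coatom {u v : V} : (coatom u : GreechieLogic G) ≤ coatom v ↔ u = v :=
  Iff.rfl
@[simp] theorem atom_le_coatom {u v : V} : (atom u : GreechieLogic G) ≤ coatom v ↔ G.Adj u v :=
  Iff.rfl
@[simp] theorem not_coatom_le_atom {u v : V} : ¬ (coatom u : GreechieLogic G) ≤ atom v := id

theorem isLUB_pair_iff {x y z : GreechieLogic G} :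
    IsLUB {x, y} z ↔ (x ≤ z ∧ y ≤ z) ∧ ∀ w, x ≤ w → y ≤ w → z ≤ w := by
  simp [IsLUB, IsLeast, mem_lowerBounds]

theorem isLUB_bot_left (x : GreechieLogic G) : IsLUB {⊥, x} x := by
  simp +contextual [isLUB_pair_iff]

theorem isLUB_bot_right (x : GreechieLogic G) : IsLUB {x, ⊥} x := by
  simp +contextual [isLUB_pair_iff]

theorem isLUB_compl (x : GreechieLogic G) : IsLUB {x, xᶜ} ⊤ := by
  refine isLUB_pair_iff.2 ⟨⟨le_top, le_top⟩, fun w hx hx' => ?_⟩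
  cases x <;> cases w <;> simp_all

/-- The join of two atoms of a triangle is the coatom of the third vertex: by uniqueness of triangles
no other coatom lies above both. -/
theorem isLUB_atom_atom (hG : UniqueTriangles G) {u v w : V} (huv : G.Adj u v) (huw : G.Adj u w)
    (hvw : G.Adj v w) : IsLUB {(atom u : GreechieLogic G), atom v} (coatom w) := by
  refine isLUB_pair_iff.2 ⟨⟨huw, hvw⟩, fun z hu hv => ?_⟩
  cases z with
  | bot => exact hu.elim
  | top => exact le_top
  | atom t =>
    rw [atom_le_atom] at hu hv
    exact (huv.ne (hu.trans hv.symm)).elim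
  | coatom t => exact (hG u v huv).unique ⟨huw, hvw⟩ ⟨hu, hv⟩

theorem orthogonal_cases {x y : GreechieLogic G} (hxy : x ≤ yᶜ) :
    x = ⊥ ∨ y = ⊥ ∨ y = xᶜ ∨ ∃ u v, G.Adj u v ∧ x = atom u ∧ y = atom v := by
  cases x <;> cases y <;> simp_all

/-- The joins of orthogonal elements, by the kind of the elements. -/
theorem isLUB_cases (hG : UniqueTriangles G) {x y z : GreechieLogic G} (hxy : x ≤ yᶜ)
    (hz : IsLUB {x, y} z) :
    (x = ⊥ ∧ z = y) ∨ (y = ⊥ ∧ z = x) ∨ (y = xᶜ ∧ z = ⊤) ∨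
      ∃ u v w, G.Adj u v ∧ G.Adj u w ∧ G.Adj v w ∧ x = atom u ∧ y = atom v ∧ z = coatom w := by
  rcases orthogonal_cases hxy with rfl | rfl | rfl | ⟨u, v, huv, rfl, rfl⟩
  · exact .inl ⟨rfl, hz.unique (isLUB_bot_left _)⟩
  · exact .inr (.inl ⟨rfl, hz.unique (isLUB_bot_right _)⟩)
  · exact .inr (.inr (.inl ⟨rfl, hz.unique (isLUB_compl _)⟩))
  · obtain ⟨w, ⟨huw, hvw⟩, -⟩ := hG u v huv
    exact .inr (.inr (.inr ⟨u, v, w, huv, huw, hvw, rfl, rfl,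
      hz.unique (isLUB_atom_atom hG huv huw hvw)⟩))

instance [hG : Fact (UniqueTriangles G)] : OrthomodularPoset (GreechieLogic G) where
  compl_compl' x := by cases x <;> rfl
  compl_antitone' x y h := by
    cases x <;> cases y <;> simp_all [SimpleGraph.adj_comm]
  sup_compl' := isLUB_compl
  exists_sup' x y h := by
    rcases orthogonal_cases h with rfl | rfl | rfl | ⟨u, v, huv, rfl, rfl⟩
    · exact ⟨_, isLUB_bot_left _⟩
    · exact ⟨_, isLUB_bot_right _⟩
    · exact ⟨_, isLUB_compl _⟩
    · obtain ⟨w, ⟨huw, hvw⟩, -⟩ := hG.out u v huv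
      exact ⟨_, isLUB_atom_atom hG.out huv huw hvw⟩
  orthomodular' x y w hxy hw := by
    have hyy : yᶜᶜ = y := by cases y <;> rfl
    rcases isLUB_cases hG.out (hyy.symm ▸ hxy) hw with
      ⟨rfl, rfl⟩ | ⟨hy, rfl⟩ | ⟨hy, rfl⟩ | ⟨u, v, t, huv, hut, hvt, rfl, hy, rfl⟩
    · simpa [hyy] using isLUB_bot_left y
    · obtain rfl : y = ⊤ := by rw [← hyy, hy, compl_bot]
      exact isLUB_compl w
    · obtain rfl : y = x := by rw [← hyy, hy]; cases x <;> rfl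
      exact isLUB_bot_right y
    · obtain rfl : y = coatom v := by rw [← hyy, hy, compl_atom]
      exact isLUB_atom_atom hG.out hut huv hvt.symm

theorem isAtom_iff [Nonempty V] (hV : ∀ v, ∃ w, G.Adj v w) {x : GreechieLogic G} :
    IsAtom x ↔ ∃ v, x = atom v := by
  constructor
  · intro h
    cases x with
    | bot => exact (h.1 rfl).elim
    | top =>
      have := h.2 (atom (Classical.arbitrary V)) (lt_of_le_not_ge le_top (by simp))
      cases this
    | atom v => exact ⟨v, rfl⟩
    | coatom v =>
      obtain ⟨w, hw⟩ := hV v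
      have := h.2 (atom w) (lt_of_le_not_ge (by simpa using hw.symm) (by simp))
      cases this
  · rintro ⟨v, rfl⟩
    refine ⟨nofun, fun y hy => ?_⟩
    cases y with
    | bot => rfl
    | top => exact (hy.not_ge le_top).elim
    | atom w =>
      obtain rfl : w = v := hy.le
      exact (lt_irrefl _ hy).elim
    | coatom w => exact (hy.le).elim

instance [Finite V] : Finite (GreechieLogic G) := by
  refine Finite.of_surjective (fun o : Bool ⊕ V ⊕ V => match o with
    | .inl true => (⊤ : GreechieLogic G)
    | .inl false => ⊥
    | .inr (.inl v) => atom v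
    | .inr (.inr v) => coatom v) fun x => ?_
  cases x with
  | bot => exact ⟨.inl false, rfl⟩
  | top => exact ⟨.inl true, rfl⟩
  | atom v => exact ⟨.inr (.inl v), rfl⟩
  | coatom v => exact ⟨.inr (.inr v), rfl⟩

/-! ### States of a Greechie logic -/

/-- The extension of a weight function on the vertices to the whole logic. -/
def stateOfWeight (w : V → ℝ) : GreechieLogic G → ℝ
  | bot => 0
  | top => 1
  | atom v => w v
  | coatom v => 1 - w v

theorem stateOfWeight_compl (w : V → ℝ) (x : GreechieLogic G) :
    stateOfWeight w xᶜ = 1 - stateOfWeight w x := by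
  cases x with
  | bot => exact (sub_zero 1).symm
  | top => exact (sub_self 1).symm
  | atom v => rfl
  | coatom v => exact (sub_sub_cancel 1 _).symm

/-- A nonnegative function with sum `1` over every triangle extends to a state. -/
theorem stateOfWeight_mem [Fact (UniqueTriangles G)] (hV : ∀ v, ∃ w, G.Adj v w) {w : V → ℝ}
    (h0 : ∀ v, 0 ≤ w v)
    (h1 : ∀ u v t, G.Adj u v → G.Adj u t → G.Adj v t → w u + w v + w t = 1) :
    (stateOfWeight w : GreechieLogic G → ℝ) ∈ stateSpace (GreechieLogic G) := by
  have hG : UniqueTriangles G := Fact.out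
  have hle : ∀ v, w v ≤ 1 := fun v => by
    obtain ⟨u, hu⟩ := hV v
    obtain ⟨t, ⟨hvt, hut⟩, -⟩ := hG v u hu
    linarith [h1 v u t hu hvt hut, h0 u, h0 t]
  refine ⟨fun x => ?_, rfl, fun x y z hxy hz => ?_⟩
  · cases x with
    | bot => norm_num [stateOfWeight]
    | top => norm_num [stateOfWeight]
    | atom v => exact ⟨h0 v, hle v⟩
    | coatom v => exact ⟨sub_nonneg.2 (hle v), sub_le_self _ (h0 v)⟩
  · rcases isLUB_cases hG hxy hz with
      ⟨rfl, rfl⟩ | ⟨rfl, rfl⟩ | ⟨rfl, rfl⟩ | ⟨u, v, t, huv, hut, hvt, rfl, rfl, rfl⟩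
    · exact (zero_add _).symm
    · exact (add_zero _).symm
    · rw [stateOfWeight_compl]
      exact (add_sub_cancel _ _).symm
    · change 1 - w t = w u + w v
      linarith [h1 u v t huv hut hvt]

section

variable [Fact (UniqueTriangles G)] {s : GreechieLogic G → ℝ}

theorem state_bot (hs : s ∈ stateSpace (GreechieLogic G)) : s ⊥ = 0 := by
  have := hs.2.2 ⊥ ⊥ ⊥ bot_le (isLUB_bot_left _)
  linarith

theorem state_coatom (hs : s ∈ stateSpace (GreechieLogic G)) (v : V) :
    s (coatom v) = 1 - s (atom v) := by
  have := hs.2.2 (atom v) (coatom v) ⊤ le_rfl (isLUB_compl _)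
  linarith [hs.2.1]

theorem eq_stateOfWeight (hs : s ∈ stateSpace (GreechieLogic G)) :
    s = stateOfWeight fun v => s (atom v) := by
  funext x
  cases x with
  | bot => exact state_bot hs
  | top => exact hs.2.1
  | atom v => rfl
  | coatom v => exact state_coatom hs v

theorem state_triangle (hs : s ∈ stateSpace (GreechieLogic G)) {u v w : V} (huv : G.Adj u v)
    (huw : G.Adj u w) (hvw : G.Adj v w) : s (atom u) + s (atom v) + s (atom w) = 1 := by
  have := hs.2.2 (atom u) (atom v) (coatom w) huv (isLUB_atom_atom Fact.out huv huw hvw)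
  linarith [state_coatom hs w]

end

end GreechieLogic

/-! ### Configurations of three-element blocks -/

/-- The list `B` of sets is a configuration on the points `1, …, m` whose Greechie logic is a
`(3, 3)`-homogeneous orthomodular poset: the sets have three elements, every point is in three of them,
and two points of a set have no common neighbour outside that set. The last condition excludes loops
of orders two and three at once. -/
structure IsConfiguration (m : ℕ) (B : Finset (Finset ℕ)) : Prop where
  pos : 0 < m
  subset : ∀ b ∈ B, b ⊆ Finset.Icc 1 m
  card : ∀ b ∈ B, b.card = 3
  degree : ∀ i ∈ Finset.Icc 1 m, (B.filter (i ∈ ·)).card = 3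
  inter_subset : ∀ b ∈ B, ∀ i ∈ b, ∀ j ∈ b, i ≠ j → ∀ c ∈ B, i ∈ c → ∀ d ∈ B, j ∈ d → c ∩ d ⊆ b

instance (m : ℕ) (B : Finset (Finset ℕ)) : Decidable (IsConfiguration m B) :=
  decidable_of_iff
    (0 < m ∧ (∀ b ∈ B, b ⊆ Finset.Icc 1 m) ∧ (∀ b ∈ B, b.card = 3) ∧
      (∀ i ∈ Finset.Icc 1 m, (B.filter (i ∈ ·)).card = 3) ∧
      ∀ b ∈ B, ∀ i ∈ b, ∀ j ∈ b, i ≠ j → ∀ c ∈ B, i ∈ c → ∀ d ∈ B, j ∈ d → c ∩ d ⊆ b)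
    ⟨fun ⟨h1, h2, h3, h4, h5⟩ => ⟨h1, h2, h3, h4, h5⟩,
      fun ⟨h1, h2, h3, h4, h5⟩ => ⟨h1, h2, h3, h4, h5⟩⟩


/-- The orthogonality graph of a configuration: distinct points are adjacent if they share a block. -/
def blockGraph (m : ℕ) (B : Finset (Finset ℕ)) : SimpleGraph (Finset.Icc 1 m) where
  Adj u v := u ≠ v ∧ ∃ b ∈ B, u.1 ∈ b ∧ v.1 ∈ b
  symm := ⟨fun _ _ h => ⟨h.1.symm, h.2.imp fun _ hb => ⟨hb.1, hb.2.2, hb.2.1⟩⟩⟩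
  loopless := ⟨fun _ h => h.1 rfl⟩

/-- The enumeration of the atoms of the Greechie logic of a configuration, with junk value `⊥` outside
`1, …, m`. -/
def blockAtom (m : ℕ) (B : Finset (Finset ℕ)) (i : ℕ) : GreechieLogic (blockGraph m B) :=
  if h : i ∈ Finset.Icc 1 m then .atom ⟨i, h⟩ else ⊥

theorem blockAtom_le_compl {m : ℕ} {B : Finset (Finset ℕ)} {i j : ℕ} (hi : i ∈ Icc 1 m)
    (hj : j ∈ Icc 1 m) (hij : i ≠ j) :
    blockAtom m B i ≤ (blockAtom m B j)ᶜ ↔ ∃ b ∈ B, i ∈ b ∧ j ∈ b := by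
  rw [← Finset.coe_Icc, Finset.mem_coe] at hi hj
  simp only [blockAtom, hi, hj, dif_pos, GreechieLogic.compl_atom, GreechieLogic.atom_le_coatom]
  simp [blockGraph, hij]

/-- The weights of a configuration: nonnegative functions on the points with sum `1` over every block.
They are extended by zero outside `1, …, m`. -/
def weights (m : ℕ) (B : Finset (Finset ℕ)) : Set (ℕ → ℝ) :=
  {w | (∀ i ∈ Finset.Icc 1 m, 0 ≤ w i) ∧ (∀ i ∉ Finset.Icc 1 m, w i = 0) ∧
    ∀ b ∈ B, ∑ i ∈ b, w i = 1}

theorem convex_weights (m : ℕ) (B : Finset (Finset ℕ)) : Convex ℝ (weights m B) := by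
  rintro v ⟨hv0, hv, hv1⟩ w ⟨hw0, hw, hw1⟩ a b ha hb hab
  refine ⟨fun i hi => ?_, fun i hi => ?_, fun c hc => ?_⟩
  · have := hv0 i hi
    have := hw0 i hi
    simp only [Pi.add_apply, Pi.smul_apply, smul_eq_mul]
    positivity
  · simp [hv i hi, hw i hi]
  · simp [Finset.sum_add_distrib, ← Finset.mul_sum, hv1 c hc, hw1 c hc, hab]

namespace IsConfiguration

variable {m : ℕ} {B : Finset (Finset ℕ)}

theorem exists_block (h : IsConfiguration m B) {i : ℕ} (hi : i ∈ Finset.Icc 1 m) :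
    ∃ b ∈ B, i ∈ b := by
  have : (B.filter (i ∈ ·)).Nonempty := Finset.card_pos.1 (by rw [h.degree i hi]; norm_num)
  obtain ⟨b, hb⟩ := this
  exact ⟨b, (Finset.mem_filter.1 hb).1, (Finset.mem_filter.1 hb).2⟩

theorem exists_third (h : IsConfiguration m B) {b : Finset ℕ} (hb : b ∈ B) {i j : ℕ}
    (hi : i ∈ b) (hj : j ∈ b) (hij : i ≠ j) : ∃ k, i ≠ k ∧ j ≠ k ∧ b = {i, j, k} := by
  obtain ⟨k, hk⟩ : ((b.erase i).erase j).Nonempty := by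
    rw [← Finset.card_pos, Finset.card_erase_of_mem (by simp [hij.symm, hj]),
      Finset.card_erase_of_mem hi, h.card b hb]
    norm_num
  simp only [Finset.mem_erase] at hk
  refine ⟨k, hk.2.1.symm, hk.1.symm, (Finset.eq_of_subset_of_card_le ?_ ?_).symm⟩
  · simp [Finset.insert_subset_iff, hi, hj, hk.2.2]
  · rw [h.card b hb, Finset.card_eq_three.2 ⟨i, j, k, hij, hk.2.1.symm, hk.1.symm, rfl⟩]

/-- Two points of a block have no common neighbour outside the block. -/
theorem mem_of_adj (h : IsConfiguration m B) {b : Finset ℕ} (hb : b ∈ B)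
    {u v w : Finset.Icc 1 m} (hu : u.1 ∈ b) (hv : v.1 ∈ b) (huv : u ≠ v)
    (huw : (blockGraph m B).Adj u w) (hvw : (blockGraph m B).Adj v w) : w.1 ∈ b := by
  obtain ⟨-, c, hc, huc, hwc⟩ := huw
  obtain ⟨-, d, hd, hvd, hwd⟩ := hvw
  exact h.inter_subset b hb u hu v hv (Subtype.coe_ne_coe.2 huv) c hc huc d hd hvd
    (Finset.mem_inter.2 ⟨hwc, hwd⟩)

theorem uniqueTriangles (h : IsConfiguration m B) :
    UniqueTriangles (blockGraph m B) := by
  rintro u v ⟨huv, b, hb, hu, hv⟩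
  obtain ⟨k, huk, hvk, hbk⟩ := h.exists_third hb hu hv (Subtype.coe_ne_coe.2 huv)
  have hkb : k ∈ b := by simp [hbk]
  refine ⟨⟨k, h.subset b hb hkb⟩, ⟨⟨?_, b, hb, hu, hkb⟩, ⟨?_, b, hb, hv, hkb⟩⟩, ?_⟩
  · exact fun e => huk (congrArg Subtype.val e)
  · exact fun e => hvk (congrArg Subtype.val e)
  · rintro w ⟨huw, hvw⟩
    have := h.mem_of_adj hb hu hv huv huw hvw
    rw [hbk] at this
    simp only [Finset.mem_insert, Finset.mem_singleton] at this
    rcases this with e | e | e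
    · exact (huw.ne (Subtype.ext e.symm)).elim
    · exact (hvw.ne (Subtype.ext e.symm)).elim
    · exact Subtype.ext e

theorem exists_adj (h : IsConfiguration m B) (v : Finset.Icc 1 m) :
    ∃ w, (blockGraph m B).Adj v w := by
  obtain ⟨b, hb, hv⟩ := h.exists_block v.2
  obtain ⟨j, hj, hvj⟩ := Finset.exists_mem_ne (by rw [h.card b hb]; norm_num) v.1
  exact ⟨⟨j, h.subset b hb hj⟩, fun e => hvj (congrArg Subtype.val e).symm, b, hb, hv, hj⟩

theorem bijOn_blockAtom (h : IsConfiguration m B) [Fact (UniqueTriangles (blockGraph m B))] :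
    BijOn (blockAtom m B) (Icc 1 m) (atoms (GreechieLogic (blockGraph m B))) := by
  have : Nonempty (Finset.Icc 1 m) := ⟨⟨1, Finset.mem_Icc.2 ⟨le_rfl, h.pos⟩⟩⟩
  refine ⟨fun i hi => ?_, fun i hi j hj hij => ?_, fun x hx => ?_⟩
  · rw [← Finset.coe_Icc, Finset.mem_coe] at hi
    exact (GreechieLogic.isAtom_iff h.exists_adj).2 ⟨⟨i, hi⟩, by simp only [blockAtom, hi, dif_pos]⟩
  · rw [← Finset.coe_Icc, Finset.mem_coe] at hi hj
    simpa only [blockAtom, hi, hj, dif_pos, GreechieLogic.atom.injEq, Subtype.mk.injEq] using hij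
  · obtain ⟨v, rfl⟩ := (GreechieLogic.isAtom_iff h.exists_adj).1 hx
    exact ⟨v.1, Finset.mem_Icc.1 v.2, by simp only [blockAtom, v.2, dif_pos]⟩

/-- The sets of the list are maximal, since a further orthogonal atom would be a common neighbour of
two points of the set. -/
theorem isBlock_image (h : IsConfiguration m B) [Fact (UniqueTriangles (blockGraph m B))]
    {b : Finset ℕ} (hb : b ∈ B) : IsBlock (blockAtom m B '' (b : Set ℕ)) := by
  have hbm : ∀ i ∈ b, i ∈ Icc 1 m := fun i hi => Finset.mem_Icc.1 (h.subset b hb hi)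
  refine ⟨⟨?_, ?_⟩, ?_⟩
  · rintro _ ⟨i, hi, rfl⟩
    exact h.bijOn_blockAtom.mapsTo (hbm i hi)
  · rintro _ ⟨i, hi, rfl⟩ _ ⟨j, hj, rfl⟩ hij
    exact (blockAtom_le_compl (hbm i hi) (hbm j hj) (ne_of_apply_ne _ hij)).2 ⟨b, hb, hi, hj⟩
  · rintro A ⟨hA, hAo⟩ hbA x hx
    obtain ⟨k, hk, rfl⟩ := h.bijOn_blockAtom.surjOn (hA hx)
    refine ⟨k, by_contra fun hkb => ?_, rfl⟩
    obtain ⟨i, j, l, hij, -, -, rfl⟩ := Finset.card_eq_three.1 (h.card b hb)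
    have key : ∀ t ∈ ({i, j, l} : Finset ℕ), ∃ c ∈ B, t ∈ c ∧ k ∈ c := fun t ht => by
      have htk : t ≠ k := fun e => hkb (e ▸ ht)
      exact (blockAtom_le_compl (hbm t ht) hk htk).1
        (hAo _ (hbA ⟨t, ht, rfl⟩) _ hx fun e => htk (h.bijOn_blockAtom.injOn (hbm t ht) hk e))
    have hi : i ∈ ({i, j, l} : Finset ℕ) := by simp
    have hj : j ∈ ({i, j, l} : Finset ℕ) := by simp
    obtain ⟨c, hc, hic, hkc⟩ := key i hi
    obtain ⟨d, hd, hjd, hkd⟩ := key j hj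
    exact hkb (h.inter_subset _ hb i hi j hj hij c hc hic d hd hjd (Finset.mem_inter.2 ⟨hkc, hkd⟩))

/-- An orthogonal set of atoms lies in a block of the list: a third element is a common neighbour of
two elements, hence in their block. -/
theorem exists_subset_image (h : IsConfiguration m B) [Fact (UniqueTriangles (blockGraph m B))]
    {A : Set (GreechieLogic (blockGraph m B))} (hA : IsOrthogonalSetOfAtoms A) :
    ∃ b ∈ B, A ⊆ blockAtom m B '' (b : Set ℕ) := by
  rcases A.subsingleton_or_nontrivial with hs | ⟨x, hx, y, hy, hxy⟩
  · obtain ⟨i, hi, hiA⟩ : ∃ i ∈ Icc 1 m, A ⊆ {blockAtom m B i} := by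
      rcases A.eq_empty_or_nonempty with rfl | ⟨x, hx⟩
      · exact ⟨1, ⟨le_rfl, h.pos⟩, empty_subset _⟩
      · obtain ⟨i, hi, rfl⟩ := h.bijOn_blockAtom.surjOn (hA.1 hx)
        exact ⟨i, hi, fun y hy => hs hy hx⟩
    obtain ⟨b, hb, hib⟩ := h.exists_block (Finset.mem_Icc.2 hi)
    exact ⟨b, hb, hiA.trans (singleton_subset_iff.2 ⟨i, hib, rfl⟩)⟩
  · obtain ⟨i, hi, rfl⟩ := h.bijOn_blockAtom.surjOn (hA.1 hx)
    obtain ⟨j, hj, rfl⟩ := h.bijOn_blockAtom.surjOn (hA.1 hy)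
    have hij : i ≠ j := ne_of_apply_ne _ hxy
    obtain ⟨b, hb, hib, hjb⟩ := (blockAtom_le_compl hi hj hij).1 (hA.2 _ hx _ hy hxy)
    refine ⟨b, hb, fun z hz => ?_⟩
    obtain ⟨k, hk, rfl⟩ := h.bijOn_blockAtom.surjOn (hA.1 hz)
    refine ⟨k, ?_, rfl⟩
    by_cases hik : i = k
    · exact hik ▸ hib
    by_cases hjk : j = k
    · exact hjk ▸ hjb
    obtain ⟨c, hc, hic, hkc⟩ := (blockAtom_le_compl hi hk hik).1
      (hA.2 _ hx _ hz fun e => hik (h.bijOn_blockAtom.injOn hi hk e))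
    obtain ⟨d, hd, hjd, hkd⟩ := (blockAtom_le_compl hj hk hjk).1
      (hA.2 _ hy _ hz fun e => hjk (h.bijOn_blockAtom.injOn hj hk e))
    exact h.inter_subset b hb i hib j hjb hij c hc hic d hd hjd (Finset.mem_inter.2 ⟨hkc, hkd⟩)

theorem hasBlockList (h : IsConfiguration m B) [Fact (UniqueTriangles (blockGraph m B))] :
    HasBlockList m B (blockAtom m B) := by
  refine ⟨inferInstance, h.bijOn_blockAtom, fun A => ⟨fun hA => ?_, ?_⟩⟩
  · obtain ⟨b, hb, hAb⟩ := h.exists_subset_image hA.prop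
    exact ⟨b, hb, hA.eq_of_subset (h.isBlock_image hb).prop hAb⟩
  · rintro ⟨b, hb, rfl⟩
    exact h.isBlock_image hb

theorem isHomogeneous (h : IsConfiguration m B) [Fact (UniqueTriangles (blockGraph m B))] :
    IsHomogeneous 3 3 (GreechieLogic (blockGraph m B)) := by
  have hinj : InjOn (blockAtom m B) (Icc 1 m) := h.bijOn_blockAtom.injOn
  have hsub : ∀ b ∈ B, (b : Set ℕ) ⊆ Icc 1 m := fun b hb => by
    rw [← Finset.coe_Icc]
    exact Finset.coe_subset.2 (h.subset b hb)
  refine ⟨fun x hx => ?_, fun A hA => ?_⟩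
  · obtain ⟨i, hi, rfl⟩ := h.bijOn_blockAtom.surjOn hx
    have hset : {A | IsBlock A ∧ blockAtom m B i ∈ A} =
        (fun b : Finset ℕ => blockAtom m B '' (b : Set ℕ)) '' (B.filter (i ∈ ·) : Set _) := by
      ext A
      simp only [mem_ofPred_eq, h.hasBlockList.2.2, mem_image, Finset.coe_filter]
      constructor
      · rintro ⟨⟨b, hb, rfl⟩, hi'⟩
        exact ⟨b, ⟨hb, Finset.mem_coe.1 ((hinj.mem_image_iff (hsub b hb) hi).1 hi')⟩, rfl⟩
      · rintro ⟨b, ⟨hb, hib⟩, rfl⟩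
        exact ⟨⟨b, hb, rfl⟩, i, hib, rfl⟩
    rw [hset, InjOn.encard_image, encard_coe_eq_coe_finsetCard, h.degree i (Finset.mem_Icc.2 hi)]
    intro b hb c hc hbc
    exact Finset.coe_injective ((hinj.image_eq_image_iff
      (hsub b (Finset.mem_filter.1 hb).1) (hsub c (Finset.mem_filter.1 hc).1)).1 hbc)
  · obtain ⟨b, hb, rfl⟩ := (h.hasBlockList.2.2 A).1 hA
    rw [(hinj.mono (hsub b hb)).encard_image, encard_coe_eq_coe_finsetCard, h.card b hb]

/-- A state is determined by its values on the atoms, and these values can be any weights. -/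
theorem bijOn_weights (h : IsConfiguration m B) [Fact (UniqueTriangles (blockGraph m B))] :
    BijOn (fun (s : GreechieLogic (blockGraph m B) → ℝ) i => s (blockAtom m B i))
      (stateSpace (GreechieLogic (blockGraph m B))) (weights m B) := by
  have hatom : ∀ v : Finset.Icc 1 m, blockAtom m B v = .atom v := fun v => by
    simp only [blockAtom, v.2, dif_pos]
  refine ⟨fun s hs => ⟨fun i _ => (hs.1 _).1, fun i hi => ?_, fun b hb => ?_⟩,
    fun s hs t ht hst => ?_, fun w hw => ?_⟩
  · simp only [blockAtom, hi, dif_neg, not_false_eq_true, GreechieLogic.state_bot hs]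
  · obtain ⟨i, j, k, hij, hik, hjk, hbe⟩ := Finset.card_eq_three.1 (h.card b hb)
    have hi : i ∈ b := by simp [hbe]
    have hj : j ∈ b := by simp [hbe]
    have hk : k ∈ b := by simp [hbe]
    have adj : ∀ p (hp : p ∈ b) q (hq : q ∈ b), p ≠ q →
        (blockGraph m B).Adj ⟨p, h.subset b hb hp⟩ ⟨q, h.subset b hb hq⟩ :=
      fun p hp q hq hpq => ⟨fun e => hpq (congrArg Subtype.val e), b, hb, hp, hq⟩
    have := GreechieLogic.state_triangle hs (adj i hi j hj hij) (adj i hi k hk hik)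
      (adj j hj k hk hjk)
    rw [← hatom, ← hatom, ← hatom] at this
    rw [hbe, Finset.sum_insert (by simp [hij, hik]), Finset.sum_insert (by simp [hjk]),
      Finset.sum_singleton, ← add_assoc]
    exact this
  · rw [GreechieLogic.eq_stateOfWeight hs, GreechieLogic.eq_stateOfWeight ht]
    congr 1
    funext v
    simpa only [hatom] using congrFun hst v
  · refine ⟨GreechieLogic.stateOfWeight fun v => w v,
      GreechieLogic.stateOfWeight_mem h.exists_adj (fun v => hw.1 v v.2) ?_, ?_⟩
    · rintro u v t ⟨huv, b, hb, hu, hv⟩ hut hvt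
      have ht : t.1 ∈ b := h.mem_of_adj hb hu hv huv hut hvt
      have hbe : {u.1, v.1, t.1} = b := by
        refine Finset.eq_of_subset_of_card_le (by simp [Finset.insert_subset_iff, hu, hv, ht]) ?_
        rw [h.card b hb, Finset.card_eq_three.2 ⟨u.1, v.1, t.1, Subtype.coe_ne_coe.2 huv,
          Subtype.coe_ne_coe.2 hut.ne, Subtype.coe_ne_coe.2 hvt.ne, rfl⟩]
      have := hw.2.2 b hb
      rw [← hbe,
        Finset.sum_insert (by simp [Subtype.coe_ne_coe.2 huv, Subtype.coe_ne_coe.2 hut.ne]),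
        Finset.sum_insert (by simp [Subtype.coe_ne_coe.2 hvt.ne]), Finset.sum_singleton] at this
      linarith
    · funext i
      by_cases hi : i ∈ Finset.Icc 1 m
      · exact congrArg _ (hatom ⟨i, hi⟩)
      · simp only [blockAtom, hi, dif_neg, not_false_eq_true, hw.2.1]
        rfl

end IsConfiguration

/-! ### Extreme points -/

/-- An injective linear image of a convex set has the images of the extreme points as its extreme
points; injectivity is only needed on the set. -/
theorem image_extremePoints_of_bijOn {E F : Type*} [AddCommGroup E] [Module ℝ E] [AddCommGroup F]
    [Module ℝ F] {f : E → F} (hf : IsLinearMap ℝ f) {S : Set E} {P : Set F} (hS : Convex ℝ S)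
    (hb : BijOn f S P) : f '' S.extremePoints ℝ = P.extremePoints ℝ := by
  have hcomb : ∀ (a b : ℝ) (x y : E), f (a • x + b • y) = a • f x + b • f y := fun a b x y => by
    rw [hf.map_add, hf.map_smul, hf.map_smul]
  ext p
  simp only [mem_image, mem_extremePoints_iff_left]
  constructor
  · rintro ⟨s, ⟨hs, hext⟩, rfl⟩
    refine ⟨hb.mapsTo hs, fun p hp q hq ⟨a, b, ha, hb', hab, he⟩ => ?_⟩
    obtain ⟨x, hx, rfl⟩ := hb.surjOn hp
    obtain ⟨y, hy, rfl⟩ := hb.surjOn hq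
    rw [← hcomb] at he
    have := hb.injOn (hS hx hy ha.le hb'.le hab) hs he
    rw [hext x hx y hy ⟨a, b, ha, hb', hab, this⟩]
  · rintro ⟨hp, hext⟩
    obtain ⟨s, hs, rfl⟩ := hb.surjOn hp
    refine ⟨s, ⟨hs, fun x hx y hy ⟨a, b, ha, hb', hab, he⟩ => ?_⟩, rfl⟩
    refine hb.injOn hx hs (hext _ (hb.mapsTo hx) _ (hb.mapsTo hy) ⟨a, b, ha, hb', hab, ?_⟩)
    rw [← hcomb, he]

/-- In a convex set, a point which is not the centre of a nontrivial segment is extreme. -/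
theorem mem_extremePoints_of_add_sub {E : Type*} [AddCommGroup E] [Module ℝ E] {P : Set E}
    (hP : Convex ℝ P) {v : E} (hv : v ∈ P) (h : ∀ d, v + d ∈ P → v - d ∈ P → d = 0) :
    v ∈ P.extremePoints ℝ := by
  refine mem_extremePoints_iff_left.2 ⟨hv, fun x hx y hy ⟨a, b, ha, hb, hab, he⟩ => ?_⟩
  -- If `v = a • x + b • y`, then `v ± min a b • (x - y)` still lie on the segment from `x` to `y`.
  have hmin : 0 < min a b := lt_min ha hb
  have h1 : v + (min a b) • (x - y) ∈ P := by
    have := hP hx hy (a := a + min a b) (b := b - min a b) (by positivity)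
      (sub_nonneg.2 (min_le_right a b)) (by linarith)
    convert this using 1
    rw [← he]
    module
  have h2 : v - (min a b) • (x - y) ∈ P := by
    have := hP hx hy (a := a - min a b) (b := b + min a b) (sub_nonneg.2 (min_le_left a b))
      (by positivity) (by linarith)
    convert this using 1
    rw [← he]
    module
  have hxy : x = y := sub_eq_zero.1 ((smul_eq_zero.1 (h _ h1 h2)).resolve_left hmin.ne')
  rw [← he, ← hxy, ← add_smul, hab, one_smul]

/-- A convex combination of points of `V` lies in the convex hull of `V`. The default tactics check the
conditions for an explicit affine formula `w` for the barycentric coordinates in a simplex. -/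
theorem mem_convexHull_of_weights {E : Type*} [AddCommGroup E] [Module ℝ E] {V : Set E} {n : ℕ}
    (v : Fin n → E) (w : Fin n → ℝ) {p : E}
    (hv : ∀ i, v i ∈ V := by simp [Fin.forall_fin_succ])
    (hw : ∀ i, 0 ≤ w i := by
      simp only [Fin.forall_fin_succ, IsEmpty.forall_iff, Matrix.cons_val_zero, Matrix.cons_val_succ]
      and_intros <;> first | trivial | linarith)
    (hw1 : ∑ i, w i = 1 := by simp [Fin.sum_univ_succ] <;> ring)
    (hp : ∑ i, w i • v i = p := by simp [Fin.sum_univ_succ] <;> and_intros <;> ring) :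
    p ∈ convexHull ℝ V :=
  hp ▸ (convex_convexHull ℝ V).sum_mem (fun i _ => hw i) hw1 fun i _ => subset_convexHull ℝ V (hv i)

/-- A criterion for `V` to be the set of vertices of the polytope `P`. -/
theorem extremePoints_eq_of_subset_convexHull {E : Type*} [AddCommGroup E] [Module ℝ E]
    {P V : Set E} (hP : Convex ℝ P) (hVP : V ⊆ P) (hPV : P ⊆ convexHull ℝ V)
    (h : ∀ v ∈ V, ∀ d, v + d ∈ P → v - d ∈ P → d = 0) : P.extremePoints ℝ = V := by
  refine Subset.antisymm ?_ fun v hv => mem_extremePoints_of_add_sub hP (hVP hv) (h v hv)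
  rw [hPV.antisymm (convexHull_min hVP hP)]
  exact extremePoints_convexHull_subset

/-! ### Coordinates on the state space -/

theorem convex_stateSpace (L : Type*) [OrthomodularPoset L] : Convex ℝ (stateSpace L) := by
  rintro s ⟨hs, hs1, hsa⟩ t ⟨ht, ht1, hta⟩ a b ha hb hab
  refine ⟨fun x => ⟨?_, ?_⟩, ?_, fun x y z hxy hz => ?_⟩
  · exact add_nonneg (mul_nonneg ha (hs x).1) (mul_nonneg hb (ht x).1)
  · calc a * s x + b * t x ≤ a * 1 + b * 1 := by gcongr <;> [exact (hs x).2; exact (ht x).2]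
      _ = 1 := by linarith
  · simp [hs1, ht1, hab]
  · simp only [Pi.add_apply, Pi.smul_apply, smul_eq_mul, hsa x y z hxy hz, hta x y z hxy hz]
    ring

theorem encard_atoms {L : Type*} [OrthomodularPoset L] {m : ℕ} {B : Finset (Finset ℕ)} {a : ℕ → L}
    (h : HasBlockList m B a) : (atoms L).encard = m := by
  rw [← h.2.1.image_eq, h.2.1.injOn.encard_image, ← Finset.coe_Icc, encard_coe_eq_coe_finsetCard,
    Nat.card_Icc, Nat.add_sub_cancel]

/-- The function on the points `1, …, m` with the values in a list of length `m`, extended by zero. -/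
def listWeight (l : List ℝ) (i : ℕ) : ℝ := (0 :: l).getD i 0

theorem listWeight_eq_zero {l : List ℝ} {i : ℕ} (hi : i ∉ Finset.Icc 1 l.length) :
    listWeight l i = 0 := by
  rw [Finset.mem_Icc, not_and_or, not_le, not_le, Nat.lt_one_iff] at hi
  rcases hi with rfl | hi
  · rfl
  · exact List.getD_eq_default _ _ hi

theorem listWeight_nonneg {l : List ℝ} (hl : ∀ x ∈ l, 0 ≤ x) (i : ℕ) : 0 ≤ listWeight l i := by
  by_cases hi : i < (0 :: l).length
  · rw [listWeight, List.getD_eq_getElem _ _ hi]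
    rcases List.mem_cons.1 (List.getElem_mem hi) with h | h
    · exact h.ge
    · exact hl _ h
  · exact (List.getD_eq_default _ _ (not_lt.1 hi)).ge

/-- Coordinates `π` map the weights bijectively onto `P` if all weights are given by a formula `f` in
the coordinates, and if the formula yields weights for all coordinates in `P`. -/
theorem bijOn_weights_of_section {m : ℕ} {B : Finset (Finset ℕ)} {E : Type*} {π : (ℕ → ℝ) → E}
    {f : E → List ℝ} {P : Set E} (hlen : ∀ p, (f p).length = m)
    (hπ : ∀ w ∈ weights m B, (∀ i ∈ Finset.Icc 1 m, w i = listWeight (f (π w)) i) ∧ π w ∈ P)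
    (hf : ∀ p ∈ P, (∀ x ∈ f p, 0 ≤ x) ∧ (∀ b ∈ B, ∑ i ∈ b, listWeight (f p) i = 1) ∧
      π (listWeight (f p)) = p) : BijOn π (weights m B) P := by
  refine ⟨fun w hw => (hπ w hw).2, fun v hv w hw hvw => ?_, fun p hp => ⟨listWeight (f p), ?_⟩⟩
  · funext i
    by_cases hi : i ∈ Finset.Icc 1 m
    · rw [(hπ v hv).1 i hi, (hπ w hw).1 i hi, hvw]
    · rw [hv.2.1 i hi, hw.2.1 i hi]
  · obtain ⟨h0, h1, h2⟩ := hf p hp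
    refine ⟨⟨fun i _ => listWeight_nonneg h0 i, fun i hi => listWeight_eq_zero ?_, h1⟩, h2⟩
    rwa [hlen]

theorem convex_of_bijOn {E F : Type*} [AddCommGroup E] [Module ℝ E] [AddCommGroup F]
    [Module ℝ F] {f : E → F} {S : Set E} {P : Set F} (hb : BijOn f S P) (hf : IsLinearMap ℝ f)
    (hS : Convex ℝ S) : Convex ℝ P :=
  hb.image_eq ▸ hS.is_linear_image hf

/-- The description of the states of a configuration by coordinates: if linear coordinates `π` map
the weights bijectively onto `P`, they do so for the states of the Greechie logic, and the pure states
go to the extreme points of `P`. -/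
theorem IsConfiguration.exists_logic {m : ℕ} {B : Finset (Finset ℕ)} (h : IsConfiguration m B)
    {E : Type*} [AddCommGroup E] [Module ℝ E] {π : (ℕ → ℝ) → E} (hπ : IsLinearMap ℝ π) {P V : Set E}
    (hP : BijOn π (weights m B) P) (hV : P.extremePoints ℝ = V) {k : ℕ∞} (hk : V.encard = k) :
    ∃ (L : Type) (_ : OrthomodularPoset L) (a : ℕ → L),
      HasBlockList m B a ∧ IsHomogeneous 3 3 L ∧
      BijOn (fun s : L → ℝ => π fun i => s (a i)) (stateSpace L) P ∧
      (fun s : L → ℝ => π fun i => s (a i)) '' pureStates L = V ∧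
      (pureStates L).encard = k := by
  have : Fact (UniqueTriangles (blockGraph m B)) := ⟨h.uniqueTriangles⟩
  have hb := hP.comp h.bijOn_weights
  have hlin : IsLinearMap ℝ (π ∘ fun (s : GreechieLogic (blockGraph m B) → ℝ) i =>
      s (blockAtom m B i)) := ⟨fun s t => hπ.map_add _ _, fun c s => hπ.map_smul _ _⟩
  have himage := (image_extremePoints_of_bijOn hlin (convex_stateSpace _) hb).trans hV
  refine ⟨GreechieLogic (blockGraph m B), inferInstance, blockAtom m B, h.hasBlockList,
    h.isHomogeneous, hb, himage, ?_⟩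
  rw [← hk, ← himage, InjOn.encard_image (hb.injOn.mono extremePoints_subset)]
  rfl

/-! ### The configuration with one pure state -/

theorem isConfiguration_blocks1 : IsConfiguration 19 blocks1 := by decide +kernel

/-- The only weight of `blocks1`. -/
noncomputable def weight1 (i : ℕ) : ℝ := if i ∈ Finset.Icc 1 19 then 1 / 3 else 0

theorem weights_blocks1 : weights 19 blocks1 = {weight1} := by
  ext w
  rw [mem_singleton_iff]
  constructor
  · rintro ⟨-, hw, hw1⟩
    simp [blocks1, commonBlocks] at hw1
    funext i
    by_cases hi : i ∈ Finset.Icc 1 19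
    · rw [weight1, if_pos hi]
      rw [Finset.mem_Icc] at hi
      obtain ⟨hi1, hi2⟩ := hi
      interval_cases i <;> linarith
    · rw [hw i hi, weight1, if_neg hi]
  · rintro rfl
    refine ⟨fun i _ => ?_, fun i hi => if_neg hi, fun b hb => ?_⟩
    · unfold weight1
      split_ifs
      norm_num
    · have h : ∀ i ∈ b, weight1 i = 1 / 3 := fun i hi =>
        if_pos (isConfiguration_blocks1.subset b hb hi)
      rw [Finset.sum_congr rfl h, Finset.sum_const, isConfiguration_blocks1.card b hb]
      norm_num

/-! ### The configuration with two pure states -/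

theorem isConfiguration_blocks2 : IsConfiguration 17 blocks2 := by decide +kernel

/-- The polytope of the states of `blocks2`. -/
abbrev polytope2 : Set ℝ :=
  {x | 0 ≤ x ∧ x ≤ 2 / 3}

/-- The vertices of `polytope2`. -/
abbrev vertices2 : Set ℝ :=
  {0, 2 / 3}

/-- The weights of `blocks2` in terms of the coordinates. -/
noncomputable def weight2 (x : ℝ) : List ℝ :=
  [x, 1 / 3, 2 / 3 - x, 1 / 3, 1 / 3, 1 / 3, 1 / 3, 2 / 3 - x, x, x, 1 / 3, 1 / 3, 1 / 3,
    2 / 3 - x, 2 / 3 - x, 1 / 3, x]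

theorem bijOn_weights_blocks2 :
    BijOn (fun w : ℕ → ℝ => w 1) (weights 17 blocks2) polytope2 := by
  refine bijOn_weights_of_section (f := fun p => weight2 p)
    (fun _ => rfl) ?_ ?_
  · rintro w ⟨hw0, -, hw1⟩
    simp [blocks2] at hw1
    have hw : ∀ i ∈ Finset.Icc 1 17, w i = listWeight (weight2 (w 1)) i := by
      intro i hi
      rw [Finset.mem_Icc] at hi
      obtain ⟨hi1, hi2⟩ := hi
      interval_cases i <;>
        simp only [weight2, listWeight, List.getD_cons_succ, List.getD_cons_zero] <;>
        linarith
    refine ⟨hw, ?_⟩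
    have h := fun i hi => (hw0 i hi).trans_eq (hw i hi)
    simp only [weight2, listWeight] at h
    -- The nonnegativity of these values cuts out the polytope.
    have h1 := h 1 (by decide)
    have h3 := h 3 (by decide)
    simp only [List.getD_cons_succ, List.getD_cons_zero] at h1 h3
    refine ⟨?_, ?_⟩ <;> linarith
  · rintro x hp
    simp only [mem_ofPred_eq] at hp
    obtain ⟨h1, h2⟩ := hp
    refine ⟨?_, ?_, rfl⟩
    · simp only [weight2, List.forall_mem_cons, List.not_mem_nil, IsEmpty.forall_iff, implies_true,
        and_true]
      and_intros <;> linarith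
    · simp [blocks2, weight2, listWeight]
      and_intros <;> ring

theorem polytope2_subset_convexHull : polytope2 ⊆ convexHull ℝ vertices2 := by
  rintro x hp
  simp only [mem_ofPred_eq] at hp
  obtain ⟨h1, h2⟩ := hp
  exact mem_convexHull_of_weights
    ![0, 2 / 3]
    ![1 - 3 / 2 * x, 3 / 2 * x]

theorem eq_zero_of_mem_vertices2 :
    ∀ v ∈ vertices2, ∀ d, v + d ∈ polytope2 → v - d ∈ polytope2 → d = 0 := by
  rintro _ (rfl | rfl) a hp hq
  all_goals
    obtain ⟨p1, p2⟩ := hp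
    obtain ⟨q1, q2⟩ := hq
    linarith

theorem extremePoints_polytope2 : polytope2.extremePoints ℝ = vertices2 :=
  extremePoints_eq_of_subset_convexHull
    (convex_of_bijOn bijOn_weights_blocks2 ⟨fun _ _ => rfl, fun _ _ => rfl⟩ (convex_weights _ _))
    (by rintro _ (rfl | rfl) <;> norm_num)
    polytope2_subset_convexHull eq_zero_of_mem_vertices2

theorem encard_vertices2 : vertices2.encard = 2 := by
  repeat rw [encard_insert_of_notMem (by norm_num)]
  rw [encard_singleton]
  norm_num

/-! ### The configuration with three pure states -/

theorem isConfiguration_blocks3 : IsConfiguration 18 blocks3 := by decide +kernel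

/-- The polytope of the states of `blocks3`. -/
abbrev polytope3 : Set (ℝ × ℝ) :=
  {p | 0 ≤ p.1 ∧ p.1 ≤ 1 ∧ 0 ≤ p.2 ∧ p.2 ≤ 1 ∧ p.1 + p.2 ≤ 1}

/-- The vertices of `polytope3`. -/
abbrev vertices3 : Set (ℝ × ℝ) :=
  {(0, 0), (1, 0), (0, 1)}

/-- The weights of `blocks3` in terms of the coordinates. -/
noncomputable def weight3 (x y : ℝ) : List ℝ :=
  [y, x, 1 - x - y, x, 1 - x - y, x, 1 - x - y, 1 - x - y, y, y, 1 - x - y, y, x, y, x,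
    1 - x - y, x, y]

theorem bijOn_weights_blocks3 :
    BijOn (fun w : ℕ → ℝ => (w 17, w 18)) (weights 18 blocks3) polytope3 := by
  refine bijOn_weights_of_section (f := fun p => weight3 p.1 p.2)
    (fun _ => rfl) ?_ ?_
  · rintro w ⟨hw0, -, hw1⟩
    simp [blocks3, commonBlocks] at hw1
    have hw : ∀ i ∈ Finset.Icc 1 18, w i = listWeight (weight3 (w 17) (w 18)) i := by
      intro i hi
      rw [Finset.mem_Icc] at hi
      obtain ⟨hi1, hi2⟩ := hi
      interval_cases i <;>
        simp only [weight3, listWeight, List.getD_cons_succ, List.getD_cons_zero] <;>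
        linarith
    refine ⟨hw, ?_⟩
    have h := fun i hi => (hw0 i hi).trans_eq (hw i hi)
    simp only [weight3, listWeight] at h
    -- The nonnegativity of these values cuts out the polytope.
    have h1 := h 1 (by decide)
    have h2 := h 2 (by decide)
    have h3 := h 3 (by decide)
    simp only [List.getD_cons_succ, List.getD_cons_zero] at h1 h2 h3
    refine ⟨?_, ?_, ?_, ?_, ?_⟩ <;> linarith
  · rintro ⟨x, y⟩ hp
    simp only [mem_ofPred_eq] at hp
    obtain ⟨h1, h2, h3, h4, h5⟩ := hp
    refine ⟨?_, ?_, rfl⟩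
    · simp only [weight3, List.forall_mem_cons, List.not_mem_nil, IsEmpty.forall_iff, implies_true,
        and_true]
      and_intros <;> linarith
    · simp [blocks3, commonBlocks, weight3, listWeight]
      and_intros <;> ring

theorem polytope3_subset_convexHull : polytope3 ⊆ convexHull ℝ vertices3 := by
  rintro ⟨x, y⟩ hp
  simp only [mem_ofPred_eq] at hp
  obtain ⟨h1, h2, h3, h4, h5⟩ := hp
  exact mem_convexHull_of_weights
    ![(0, 0), (0, 1), (1, 0)]
    ![1 - x - y, y, x]

theorem eq_zero_of_mem_vertices3 :
    ∀ v ∈ vertices3, ∀ d, v + d ∈ polytope3 → v - d ∈ polytope3 → d = 0 := by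
  rintro _ (rfl | rfl | rfl) ⟨a, b⟩ hp hq
  all_goals
    simp only [mem_ofPred_eq, Prod.mk_add_mk, Prod.mk_sub_mk, Prod.mk_eq_zero] at hp hq ⊢
    obtain ⟨p1, p2, p3, p4, p5⟩ := hp
    obtain ⟨q1, q2, q3, q4, q5⟩ := hq
    refine ⟨?_, ?_⟩ <;> linarith

theorem extremePoints_polytope3 : polytope3.extremePoints ℝ = vertices3 :=
  extremePoints_eq_of_subset_convexHull
    (convex_of_bijOn bijOn_weights_blocks3 ⟨fun _ _ => rfl, fun _ _ => rfl⟩ (convex_weights _ _))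
    (by rintro _ (rfl | rfl | rfl) <;> norm_num)
    polytope3_subset_convexHull eq_zero_of_mem_vertices3

theorem encard_vertices3 : vertices3.encard = 3 := by
  repeat rw [encard_insert_of_notMem (by norm_num)]
  rw [encard_singleton]
  norm_num

/-! ### The configuration with four pure states -/

theorem isConfiguration_blocks4 : IsConfiguration 19 blocks4 := by decide +kernel

/-- The polytope of the states of `blocks4`. -/
abbrev polytope4 : Set (ℝ × ℝ) :=
  {p | 0 ≤ p.1 ∧ p.1 ≤ 2 / 3 ∧ 1 / 6 ≤ p.2 ∧ p.2 ≤ 1 / 2 ∧ 1 / 2 ≤ p.1 + p.2 ∧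
    p.1 + p.2 ≤ 5 / 6}

/-- The vertices of `polytope4`. -/
abbrev vertices4 : Set (ℝ × ℝ) :=
  {(0, 1 / 2), (1 / 3, 1 / 6), (2 / 3, 1 / 6), (1 / 3, 1 / 2)}

/-- The weights of `blocks4` in terms of the coordinates. -/
noncomputable def weight4 (x y : ℝ) : List ℝ :=
  [2 * y - 1 / 3, 1 - 2 * y, 1 / 3, 2 / 3 - y, 2 / 3 - y, x, 4 / 3 - x - 2 * y, y, y, 2 / 3 - x,
    x + 2 * y - 2 / 3, 1 / 3, 1 / 3, x + y - 1 / 3, 1 - x - y, 1 - x - y, 5 / 3 - 2 * x - 2 * y,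
    x + y - 1 / 3, 2 * x + 2 * y - 1]

theorem bijOn_weights_blocks4 :
    BijOn (fun w : ℕ → ℝ => (w 6, w 8)) (weights 19 blocks4) polytope4 := by
  refine bijOn_weights_of_section (f := fun p => weight4 p.1 p.2)
    (fun _ => rfl) ?_ ?_
  · rintro w ⟨hw0, -, hw1⟩
    simp [blocks4, commonBlocks] at hw1
    have hw : ∀ i ∈ Finset.Icc 1 19, w i = listWeight (weight4 (w 6) (w 8)) i := by
      intro i hi
      rw [Finset.mem_Icc] at hi
      obtain ⟨hi1, hi2⟩ := hi
      interval_cases i <;>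
        simp only [weight4, listWeight, List.getD_cons_succ, List.getD_cons_zero] <;>
        linarith
    refine ⟨hw, ?_⟩
    have h := fun i hi => (hw0 i hi).trans_eq (hw i hi)
    simp only [weight4, listWeight] at h
    -- The nonnegativity of these values cuts out the polytope.
    have h1 := h 1 (by decide)
    have h2 := h 2 (by decide)
    have h17 := h 17 (by decide)
    have h19 := h 19 (by decide)
    simp only [List.getD_cons_succ, List.getD_cons_zero] at h1 h2 h17 h19
    refine ⟨?_, ?_, ?_, ?_, ?_, ?_⟩ <;> linarith
  · rintro ⟨x, y⟩ hp
    simp only [mem_ofPred_eq] at hp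
    obtain ⟨h1, h2, h3, h4, h5, h6⟩ := hp
    refine ⟨?_, ?_, rfl⟩
    · simp only [weight4, List.forall_mem_cons, List.not_mem_nil, IsEmpty.forall_iff, implies_true,
        and_true]
      and_intros <;> linarith
    · simp [blocks4, commonBlocks, weight4, listWeight]
      and_intros <;> ring

theorem polytope4_subset_convexHull : polytope4 ⊆ convexHull ℝ vertices4 := by
  rintro ⟨x, y⟩ hp
  simp only [mem_ofPred_eq] at hp
  obtain ⟨h1, h2, h3, h4, h5, h6⟩ := hp
  rcases le_total 1 (x + 2 * y) with h | h
  · exact mem_convexHull_of_weights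
      ![(0, 1 / 2), (1 / 3, 1 / 2), (2 / 3, 1 / 6)]
      ![5 / 2 - 3 * x - 3 * y, 3 * x + 6 * y - 3, 3 / 2 - 3 * y]
  · exact mem_convexHull_of_weights
      ![(0, 1 / 2), (1 / 3, 1 / 6), (2 / 3, 1 / 6)]
      ![3 * y - 1 / 2, 3 - 3 * x - 6 * y, 3 * x + 3 * y - 3 / 2]

theorem eq_zero_of_mem_vertices4 :
    ∀ v ∈ vertices4, ∀ d, v + d ∈ polytope4 → v - d ∈ polytope4 → d = 0 := by
  rintro _ (rfl | rfl | rfl | rfl) ⟨a, b⟩ hp hq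
  all_goals
    simp only [mem_ofPred_eq, Prod.mk_add_mk, Prod.mk_sub_mk, Prod.mk_eq_zero] at hp hq ⊢
    obtain ⟨p1, p2, p3, p4, p5, p6⟩ := hp
    obtain ⟨q1, q2, q3, q4, q5, q6⟩ := hq
    refine ⟨?_, ?_⟩ <;> linarith

theorem extremePoints_polytope4 : polytope4.extremePoints ℝ = vertices4 :=
  extremePoints_eq_of_subset_convexHull
    (convex_of_bijOn bijOn_weights_blocks4 ⟨fun _ _ => rfl, fun _ _ => rfl⟩ (convex_weights _ _))
    (by rintro _ (rfl | rfl | rfl | rfl) <;> norm_num)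
    polytope4_subset_convexHull eq_zero_of_mem_vertices4

theorem encard_vertices4 : vertices4.encard = 4 := by
  repeat rw [encard_insert_of_notMem (by norm_num)]
  rw [encard_singleton]
  norm_num

/-! ### The configuration with five pure states -/

theorem isConfiguration_blocks5 : IsConfiguration 19 blocks5 := by decide +kernel

/-- The polytope of the states of `blocks5`. -/
abbrev polytope5 : Set (ℝ × ℝ) :=
  {p | 0 ≤ p.1 ∧ p.1 ≤ 2 / 3 ∧ 0 ≤ p.2 ∧ p.2 ≤ 2 / 3 ∧ p.1 - p.2 ≤ 1 / 3}

/-- The vertices of `polytope5`. -/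
abbrev vertices5 : Set (ℝ × ℝ) :=
  {(0, 0), (0, 2 / 3), (1 / 3, 0), (2 / 3, 1 / 3), (2 / 3, 2 / 3)}

/-- The weights of `blocks5` in terms of the coordinates. -/
noncomputable def weight5 (x y : ℝ) : List ℝ :=
  [x, 1 / 3, 2 / 3 - x, 1 / 3, 2 / 3 - x, 1 / 3 + y - x, 2 / 3 - y, 1 / 3, 1 / 3, 1 / 3, 1 / 3,
    1 / 3, x, 1 / 3, x, 2 / 3 - y, 2 / 3 - y, y, y]

theorem bijOn_weights_blocks5 :
    BijOn (fun w : ℕ → ℝ => (w 15, w 19)) (weights 19 blocks5) polytope5 := by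
  refine bijOn_weights_of_section (f := fun p => weight5 p.1 p.2)
    (fun _ => rfl) ?_ ?_
  · rintro w ⟨hw0, -, hw1⟩
    simp [blocks5, commonBlocks] at hw1
    have hw : ∀ i ∈ Finset.Icc 1 19, w i = listWeight (weight5 (w 15) (w 19)) i := by
      intro i hi
      rw [Finset.mem_Icc] at hi
      obtain ⟨hi1, hi2⟩ := hi
      interval_cases i <;>
        simp only [weight5, listWeight, List.getD_cons_succ, List.getD_cons_zero] <;>
        linarith
    refine ⟨hw, ?_⟩
    have h := fun i hi => (hw0 i hi).trans_eq (hw i hi)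
    simp only [weight5, listWeight] at h
    -- The nonnegativity of these values cuts out the polytope.
    have h1 := h 1 (by decide)
    have h3 := h 3 (by decide)
    have h6 := h 6 (by decide)
    have h7 := h 7 (by decide)
    have h18 := h 18 (by decide)
    simp only [List.getD_cons_succ, List.getD_cons_zero] at h1 h3 h6 h7 h18
    refine ⟨?_, ?_, ?_, ?_, ?_⟩ <;> linarith
  · rintro ⟨x, y⟩ hp
    simp only [mem_ofPred_eq] at hp
    obtain ⟨h1, h2, h3, h4, h5⟩ := hp
    refine ⟨?_, ?_, rfl⟩
    · simp only [weight5, List.forall_mem_cons, List.not_mem_nil, IsEmpty.forall_iff, implies_true,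
        and_true]
      and_intros <;> linarith
    · simp [blocks5, commonBlocks, weight5, listWeight]
      and_intros <;> ring

theorem polytope5_subset_convexHull : polytope5 ⊆ convexHull ℝ vertices5 := by
  rintro ⟨x, y⟩ hp
  simp only [mem_ofPred_eq] at hp
  obtain ⟨h1, h2, h3, h4, h5⟩ := hp
  rcases le_total x y with h | h
  · exact mem_convexHull_of_weights
      ![(0, 0), (0, 2 / 3), (2 / 3, 2 / 3)]
      ![1 - 3 / 2 * y, 3 / 2 * y - 3 / 2 * x, 3 / 2 * x]
  · rcases le_total x (2 * y) with h | h
    · exact mem_convexHull_of_weights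
        ![(0, 0), (2 / 3, 1 / 3), (2 / 3, 2 / 3)]
        ![1 - 3 / 2 * x, 3 * x - 3 * y, 3 * y - 3 / 2 * x]
    · exact mem_convexHull_of_weights
        ![(0, 0), (1 / 3, 0), (2 / 3, 1 / 3)]
        ![1 + 3 * y - 3 * x, 3 * x - 6 * y, 3 * y]

theorem eq_zero_of_mem_vertices5 :
    ∀ v ∈ vertices5, ∀ d, v + d ∈ polytope5 → v - d ∈ polytope5 → d = 0 := by
  rintro _ (rfl | rfl | rfl | rfl | rfl) ⟨a, b⟩ hp hq
  all_goals
    simp only [mem_ofPred_eq, Prod.mk_add_mk, Prod.mk_sub_mk, Prod.mk_eq_zero] at hp hq ⊢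
    obtain ⟨p1, p2, p3, p4, p5⟩ := hp
    obtain ⟨q1, q2, q3, q4, q5⟩ := hq
    refine ⟨?_, ?_⟩ <;> linarith

theorem extremePoints_polytope5 : polytope5.extremePoints ℝ = vertices5 :=
  extremePoints_eq_of_subset_convexHull
    (convex_of_bijOn bijOn_weights_blocks5 ⟨fun _ _ => rfl, fun _ _ => rfl⟩ (convex_weights _ _))
    (by rintro _ (rfl | rfl | rfl | rfl | rfl) <;> norm_num)
    polytope5_subset_convexHull eq_zero_of_mem_vertices5

theorem encard_vertices5 : vertices5.encard = 5 := by
  repeat rw [encard_insert_of_notMem (by norm_num)]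
  rw [encard_singleton]
  norm_num

/-! ### The configuration with six pure states -/

theorem isConfiguration_blocks6 : IsConfiguration 19 blocks6 := by decide +kernel

/-- The polytope of the states of `blocks6`. -/
abbrev polytope6 : Set (ℝ × ℝ) :=
  {p | 0 ≤ p.1 ∧ p.1 ≤ 2 / 3 ∧ 1 / 6 ≤ p.2 ∧ p.2 ≤ 1 / 2 ∧ p.2 + p.1 ≤ 1 ∧ p.2 - p.1 ≤ 1 / 3}

/-- The vertices of `polytope6`. -/
abbrev vertices6 : Set (ℝ × ℝ) :=
  {(0, 1 / 6), (0, 1 / 3), (1 / 6, 1 / 2), (1 / 2, 1 / 2), (2 / 3, 1 / 3),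
      (2 / 3, 1 / 6)}

/-- The weights of `blocks6` in terms of the coordinates. -/
noncomputable def weight6 (x y : ℝ) : List ℝ :=
  [2 / 3 - x, x, 1 / 3, 1 / 3, x, 1 / 3 + x - y, y, 1 / 3, 2 / 3 - x, y, 1 - x - y, 1 / 3,
    1 / 3, 2 / 3 - y, y, y, 2 * y - 1 / 3, 1 - 2 * y, 2 / 3 - y]

theorem bijOn_weights_blocks6 :
    BijOn (fun w : ℕ → ℝ => (w 2, w 10)) (weights 19 blocks6) polytope6 := by
  refine bijOn_weights_of_section (f := fun p => weight6 p.1 p.2)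
    (fun _ => rfl) ?_ ?_
  · rintro w ⟨hw0, -, hw1⟩
    simp [blocks6, commonBlocks] at hw1
    have hw : ∀ i ∈ Finset.Icc 1 19, w i = listWeight (weight6 (w 2) (w 10)) i := by
      intro i hi
      rw [Finset.mem_Icc] at hi
      obtain ⟨hi1, hi2⟩ := hi
      interval_cases i <;>
        simp only [weight6, listWeight, List.getD_cons_succ, List.getD_cons_zero] <;>
        linarith
    refine ⟨hw, ?_⟩
    have h := fun i hi => (hw0 i hi).trans_eq (hw i hi)
    simp only [weight6, listWeight] at h
    -- The nonnegativity of these values cuts out the polytope.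
    have h1 := h 1 (by decide)
    have h2 := h 2 (by decide)
    have h6 := h 6 (by decide)
    have h11 := h 11 (by decide)
    have h17 := h 17 (by decide)
    have h18 := h 18 (by decide)
    simp only [List.getD_cons_succ, List.getD_cons_zero] at h1 h2 h6 h11 h17 h18
    refine ⟨?_, ?_, ?_, ?_, ?_, ?_⟩ <;> linarith
  · rintro ⟨x, y⟩ hp
    simp only [mem_ofPred_eq] at hp
    obtain ⟨h1, h2, h3, h4, h5, h6⟩ := hp
    refine ⟨?_, ?_, rfl⟩
    · simp only [weight6, List.forall_mem_cons, List.not_mem_nil, IsEmpty.forall_iff, implies_true,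
        and_true]
      and_intros <;> linarith
    · simp [blocks6, commonBlocks, weight6, listWeight]
      and_intros <;> ring

theorem polytope6_subset_convexHull : polytope6 ⊆ convexHull ℝ vertices6 := by
  rintro ⟨x, y⟩ hp
  simp only [mem_ofPred_eq] at hp
  obtain ⟨h1, h2, h3, h4, h5, h6⟩ := hp
  rcases le_total 1 (3 * y) with h | h
  · rcases le_total (1 + x) (3 * y) with h | h
    · exact mem_convexHull_of_weights
        ![(0, 1 / 3), (1 / 6, 1 / 2), (1 / 2, 1 / 2)]
        ![3 - 6 * y, 9 * y - 3 - 3 * x, 1 + 3 * x - 3 * y]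
    · exact mem_convexHull_of_weights
        ![(0, 1 / 3), (1 / 2, 1 / 2), (2 / 3, 1 / 3)]
        ![3 / 2 - 3 / 2 * x - 3 / 2 * y, 6 * y - 2, 3 / 2 + 3 / 2 * x - 9 / 2 * y]
  · rcases le_total (2 + 3 * x) (12 * y) with h | h
    · exact mem_convexHull_of_weights
        ![(0, 1 / 6), (0, 1 / 3), (2 / 3, 1 / 3)]
        ![2 - 6 * y, 6 * y - 1 - 3 / 2 * x, 3 / 2 * x]
    · exact mem_convexHull_of_weights
        ![(0, 1 / 6), (2 / 3, 1 / 6), (2 / 3, 1 / 3)]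
        ![1 - 3 / 2 * x, 1 + 3 / 2 * x - 6 * y, 6 * y - 1]

theorem eq_zero_of_mem_vertices6 :
    ∀ v ∈ vertices6, ∀ d, v + d ∈ polytope6 → v - d ∈ polytope6 → d = 0 := by
  rintro _ (rfl | rfl | rfl | rfl | rfl | rfl) ⟨a, b⟩ hp hq
  all_goals
    simp only [mem_ofPred_eq, Prod.mk_add_mk, Prod.mk_sub_mk, Prod.mk_eq_zero] at hp hq ⊢
    obtain ⟨p1, p2, p3, p4, p5, p6⟩ := hp
    obtain ⟨q1, q2, q3, q4, q5, q6⟩ := hq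
    refine ⟨?_, ?_⟩ <;> linarith

theorem extremePoints_polytope6 : polytope6.extremePoints ℝ = vertices6 :=
  extremePoints_eq_of_subset_convexHull
    (convex_of_bijOn bijOn_weights_blocks6 ⟨fun _ _ => rfl, fun _ _ => rfl⟩ (convex_weights _ _))
    (by rintro _ (rfl | rfl | rfl | rfl | rfl | rfl) <;> norm_num)
    polytope6_subset_convexHull eq_zero_of_mem_vertices6

theorem encard_vertices6 : vertices6.encard = 6 := by
  repeat rw [encard_insert_of_notMem (by norm_num)]
  rw [encard_singleton]
  norm_num

/-! ### The configuration with seven pure states -/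

theorem isConfiguration_blocks7 : IsConfiguration 18 blocks7 := by decide +kernel

/-- The polytope of the states of `blocks7`. -/
abbrev polytope7 : Set (ℝ × ℝ × ℝ) :=
  {p | 0 ≤ p.1 ∧ p.1 ≤ 1 ∧ 0 ≤ p.2.1 ∧ p.2.1 ≤ 1 ∧ 0 ≤ p.2.2 ∧ p.2.2 ≤ 1 / 2 ∧
    p.1 + p.2.1 ≤ 1 ∧ p.1 + p.2.2 ≤ 1 ∧ p.2.1 + p.2.2 ≤ 1}

/-- The vertices of `polytope7`. -/
abbrev vertices7 : Set (ℝ × ℝ × ℝ) :=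
  {(0, 0, 0), (0, 1, 0), (1, 0, 0), (0, 0, 1 / 2), (0, 1 / 2, 1 / 2),
      (1 / 2, 0, 1 / 2), (1 / 2, 1 / 2, 1 / 2)}

/-- The weights of `blocks7` in terms of the coordinates. -/
noncomputable def weight7 (x y z : ℝ) : List ℝ :=
  [x, 1 - x - y, y, 1 - x - z, z, 1 - x - z, z, x, y, x, y, z, 1 - y - z, z, 1 - y - z, z,
    1 - 2 * z, z]

theorem bijOn_weights_blocks7 :
    BijOn (fun w : ℕ → ℝ => (w 1, w 3, w 18)) (weights 18 blocks7) polytope7 := by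
  refine bijOn_weights_of_section (f := fun p => weight7 p.1 p.2.1 p.2.2)
    (fun _ => rfl) ?_ ?_
  · rintro w ⟨hw0, -, hw1⟩
    simp [blocks7, commonBlocks] at hw1
    have hw : ∀ i ∈ Finset.Icc 1 18, w i = listWeight (weight7 (w 1) (w 3) (w 18)) i := by
      intro i hi
      rw [Finset.mem_Icc] at hi
      obtain ⟨hi1, hi2⟩ := hi
      interval_cases i <;>
        simp only [weight7, listWeight, List.getD_cons_succ, List.getD_cons_zero] <;>
        linarith
    refine ⟨hw, ?_⟩
    have h := fun i hi => (hw0 i hi).trans_eq (hw i hi)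
    simp only [weight7, listWeight] at h
    -- The nonnegativity of these values cuts out the polytope.
    have h1 := h 1 (by decide)
    have h2 := h 2 (by decide)
    have h3 := h 3 (by decide)
    have h4 := h 4 (by decide)
    have h5 := h 5 (by decide)
    have h13 := h 13 (by decide)
    have h17 := h 17 (by decide)
    simp only [List.getD_cons_succ, List.getD_cons_zero] at h1 h2 h3 h4 h5 h13 h17
    refine ⟨?_, ?_, ?_, ?_, ?_, ?_, ?_, ?_, ?_⟩ <;> linarith
  · rintro ⟨x, y, z⟩ hp
    simp only [mem_ofPred_eq] at hp
    obtain ⟨h1, h2, h3, h4, h5, h6, h7, h8, h9⟩ := hp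
    refine ⟨?_, ?_, rfl⟩
    · simp only [weight7, List.forall_mem_cons, List.not_mem_nil, IsEmpty.forall_iff, implies_true,
        and_true]
      and_intros <;> linarith
    · simp [blocks7, commonBlocks, weight7, listWeight]
      and_intros <;> ring

theorem polytope7_subset_convexHull : polytope7 ⊆ convexHull ℝ vertices7 := by
  rintro ⟨x, y, z⟩ hp
  simp only [mem_ofPred_eq] at hp
  obtain ⟨h1, h2, h3, h4, h5, h6, h7, h8, h9⟩ := hp
  rcases le_total (1 + y) (x + 2 * z) with h | h
  · exact mem_convexHull_of_weights
      ![(0, 0, 1 / 2), (1 / 2, 0, 1 / 2), (1 / 2, 1 / 2, 1 / 2), (1, 0, 0)]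
      ![2 - 2 * x - 2 * z, 2 * x + 4 * z - 2 - 2 * y, 2 * y, 1 - 2 * z]
  · rcases le_total (1 + x) (y + 2 * z) with h | h
    · exact mem_convexHull_of_weights
        ![(0, 0, 1 / 2), (0, 1 / 2, 1 / 2), (0, 1, 0), (1 / 2, 1 / 2, 1 / 2)]
        ![2 - 2 * y - 2 * z, 2 * y + 4 * z - 2 - 2 * x, 1 - 2 * z, 2 * x]
    · rcases le_total 1 (x + y + 2 * z) with h | h
      · exact mem_convexHull_of_weights
          ![(0, 0, 1 / 2), (0, 1, 0), (1 / 2, 1 / 2, 1 / 2), (1, 0, 0)]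
          ![1 - x - y, 1 / 2 + 1 / 2 * y - 1 / 2 * x - z, x + y + 2 * z - 1,
            1 / 2 + 1 / 2 * x - 1 / 2 * y - z]
      · exact mem_convexHull_of_weights
          ![(0, 0, 0), (0, 0, 1 / 2), (0, 1, 0), (1, 0, 0)]
          ![1 - x - y - 2 * z, 2 * z, y, x]

theorem eq_zero_of_mem_vertices7 :
    ∀ v ∈ vertices7, ∀ d, v + d ∈ polytope7 → v - d ∈ polytope7 → d = 0 := by
  rintro _ (rfl | rfl | rfl | rfl | rfl | rfl | rfl) ⟨a, b, c⟩ hp hq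
  all_goals
    simp only [mem_ofPred_eq, Prod.mk_add_mk, Prod.mk_sub_mk, Prod.mk_eq_zero] at hp hq ⊢
    obtain ⟨p1, p2, p3, p4, p5, p6, p7, p8, p9⟩ := hp
    obtain ⟨q1, q2, q3, q4, q5, q6, q7, q8, q9⟩ := hq
    refine ⟨?_, ?_, ?_⟩ <;> linarith

theorem extremePoints_polytope7 : polytope7.extremePoints ℝ = vertices7 :=
  extremePoints_eq_of_subset_convexHull
    (convex_of_bijOn bijOn_weights_blocks7 ⟨fun _ _ => rfl, fun _ _ => rfl⟩ (convex_weights _ _))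
    (by rintro _ (rfl | rfl | rfl | rfl | rfl | rfl | rfl) <;> norm_num)
    polytope7_subset_convexHull eq_zero_of_mem_vertices7

theorem encard_vertices7 : vertices7.encard = 7 := by
  repeat rw [encard_insert_of_notMem (by norm_num)]
  rw [encard_singleton]
  norm_num

/-! ### The configuration with ten pure states -/

theorem isConfiguration_blocks10 : IsConfiguration 18 blocks10 := by decide +kernel

/-- The polytope of the states of `blocks10`. -/
abbrev polytope10 : Set (ℝ × ℝ × ℝ × ℝ) :=
  {p | 0 ≤ p.1 ∧ 0 ≤ p.2.1 ∧ 0 ≤ p.2.2.1 ∧ 0 ≤ p.2.2.2 ∧ p.1 + p.2.1 ≤ 1 ∧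
    p.2.1 + p.2.2.1 ≤ 1 ∧ p.2.1 + p.2.2.2 ≤ 1 ∧ p.2.2.1 + p.2.2.2 ≤ 1 ∧
    p.2.2.1 ≤ p.1 + p.2.1 ∧ p.2.2.2 ≤ p.1 + p.2.1}

/-- The vertices of `polytope10`. -/
abbrev vertices10 : Set (ℝ × ℝ × ℝ × ℝ) :=
  {(0, 0, 0, 0), (0, 1, 0, 0), (1, 0, 0, 0), (1, 0, 1, 0),
      (1, 0, 0, 1), (0, 1 / 2, 1 / 2, 0), (0, 1 / 2, 0, 1 / 2), (0, 1 / 2, 1 / 2, 1 / 2),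
      (1 / 2, 0, 1 / 2, 1 / 2), (1 / 2, 1 / 2, 1 / 2, 1 / 2)}

/-- The weights of `blocks10` in terms of the coordinates. -/
noncomputable def weight10 (x y z w : ℝ) : List ℝ :=
  [x, y, 1 - x - y, 1 - x - y, y, y, 1 - x - y, z, 1 - y - z, w, 1 - y - w, x + y - z, z,
    x + y - w, w, z, w, 1 - z - w]

theorem bijOn_weights_blocks10 :
    BijOn (fun w : ℕ → ℝ => (w 1, w 2, w 8, w 10)) (weights 18 blocks10) polytope10 := by
  refine bijOn_weights_of_section (f := fun p => weight10 p.1 p.2.1 p.2.2.1 p.2.2.2)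
    (fun _ => rfl) ?_ ?_
  · rintro w ⟨hw0, -, hw1⟩
    simp [blocks10, commonBlocks] at hw1
    have hw : ∀ i ∈ Finset.Icc 1 18, w i = listWeight (weight10 (w 1) (w 2) (w 8) (w 10)) i := by
      intro i hi
      rw [Finset.mem_Icc] at hi
      obtain ⟨hi1, hi2⟩ := hi
      interval_cases i <;>
        simp only [weight10, listWeight, List.getD_cons_succ, List.getD_cons_zero] <;>
        linarith
    refine ⟨hw, ?_⟩
    have h := fun i hi => (hw0 i hi).trans_eq (hw i hi)
    simp only [weight10, listWeight] at h
    -- The nonnegativity of these values cuts out the polytope.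
    have h1 := h 1 (by decide)
    have h2 := h 2 (by decide)
    have h3 := h 3 (by decide)
    have h8 := h 8 (by decide)
    have h9 := h 9 (by decide)
    have h10 := h 10 (by decide)
    have h11 := h 11 (by decide)
    have h12 := h 12 (by decide)
    have h14 := h 14 (by decide)
    have h18 := h 18 (by decide)
    simp only [List.getD_cons_succ, List.getD_cons_zero] at h1 h2 h3 h8 h9 h10 h11 h12 h14 h18
    refine ⟨?_, ?_, ?_, ?_, ?_, ?_, ?_, ?_, ?_, ?_⟩ <;> linarith
  · rintro ⟨x, y, z, w⟩ hp
    simp only [mem_ofPred_eq] at hp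
    obtain ⟨h1, h2, h3, h4, h5, h6, h7, h8, h9, h10⟩ := hp
    refine ⟨?_, ?_, rfl⟩
    · simp only [weight10, List.forall_mem_cons, List.not_mem_nil, IsEmpty.forall_iff, implies_true,
        and_true]
      and_intros <;> linarith
    · simp [blocks10, commonBlocks, weight10, listWeight]
      ring

theorem polytope10_subset_convexHull : polytope10 ⊆ convexHull ℝ vertices10 := by
  rintro ⟨x, y, z, w⟩ hp
  simp only [mem_ofPred_eq] at hp
  obtain ⟨h1, h2, h3, h4, h5, h6, h7, h8, h9, h10⟩ := hp
  rcases le_total x (z + w) with h | h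
  · rcases le_total (x + z) w with h | h
    · exact mem_convexHull_of_weights
        ![(0, 0, 0, 0), (0, 1 / 2, 0, 1 / 2), (0, 1 / 2, 1 / 2, 1 / 2), (0, 1, 0, 0),
          (1, 0, 0, 1)]
        ![1 - y - w, 2 * w - 2 * x - 2 * z, 2 * z, x + y - w, x]
    · rcases le_total z (x + w) with h | h
      · rcases le_total (x + 2 * y) (z + w) with h | h
        · exact mem_convexHull_of_weights
            ![(0, 0, 0, 0), (0, 1 / 2, 1 / 2, 1 / 2), (1 / 2, 0, 1 / 2, 1 / 2), (1, 0, 0, 1),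
              (1, 0, 1, 0)]
            ![1 - z - w, 2 * y, 2 * z + 2 * w - 2 * x - 4 * y, x + y - z, x + y - w]
        · rcases le_total 2 (x + 2 * y + z + w) with h | h
          · exact mem_convexHull_of_weights
              ![(0, 1 / 2, 1 / 2, 1 / 2), (0, 1, 0, 0), (1 / 2, 1 / 2, 1 / 2, 1 / 2),
                (1, 0, 0, 1), (1, 0, 1, 0)]
              ![2 - 2 * x - 2 * y, 1 - z - w, 2 * x + 4 * y + 2 * z + 2 * w - 4, 1 - y - z,
                1 - y - w]
          · exact mem_convexHull_of_weights
              ![(0, 0, 0, 0), (0, 1 / 2, 1 / 2, 1 / 2), (0, 1, 0, 0), (1, 0, 0, 1),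
                (1, 0, 1, 0)]
              ![1 - 1 / 2 * x - y - 1 / 2 * z - 1 / 2 * w, z + w - x,
                1 / 2 * x + y - 1 / 2 * z - 1 / 2 * w, 1 / 2 * x + 1 / 2 * w - 1 / 2 * z,
                1 / 2 * x + 1 / 2 * z - 1 / 2 * w]
      · exact mem_convexHull_of_weights
          ![(0, 0, 0, 0), (0, 1 / 2, 1 / 2, 0), (0, 1 / 2, 1 / 2, 1 / 2), (0, 1, 0, 0),
            (1, 0, 1, 0)]
          ![1 - y - z, 2 * z - 2 * x - 2 * w, 2 * w, x + y - z, x]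
  · exact mem_convexHull_of_weights
      ![(0, 0, 0, 0), (0, 1, 0, 0), (1, 0, 0, 0), (1, 0, 0, 1), (1, 0, 1, 0)]
      ![1 - x - y, y, x - z - w, w, z]

theorem eq_zero_of_mem_vertices10 :
    ∀ v ∈ vertices10, ∀ d, v + d ∈ polytope10 → v - d ∈ polytope10 → d = 0 := by
  rintro _ (rfl | rfl | rfl | rfl | rfl | rfl | rfl | rfl | rfl | rfl) ⟨a, b, c, d⟩ hp hq
  all_goals
    simp only [mem_ofPred_eq, Prod.mk_add_mk, Prod.mk_sub_mk, Prod.mk_eq_zero] at hp hq ⊢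
    obtain ⟨p1, p2, p3, p4, p5, p6, p7, p8, p9, p10⟩ := hp
    obtain ⟨q1, q2, q3, q4, q5, q6, q7, q8, q9, q10⟩ := hq
    refine ⟨?_, ?_, ?_, ?_⟩ <;> linarith

theorem extremePoints_polytope10 : polytope10.extremePoints ℝ = vertices10 :=
  extremePoints_eq_of_subset_convexHull
    (convex_of_bijOn bijOn_weights_blocks10 ⟨fun _ _ => rfl, fun _ _ => rfl⟩ (convex_weights _ _))
    (by rintro _ (rfl | rfl | rfl | rfl | rfl | rfl | rfl | rfl | rfl | rfl) <;> norm_num)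
    polytope10_subset_convexHull eq_zero_of_mem_vertices10

theorem encard_vertices10 : vertices10.encard = 10 := by
  repeat rw [encard_insert_of_notMem (by norm_num)]
  rw [encard_singleton]
  norm_num

/-! ### The configuration with eleven pure states -/

theorem isConfiguration_blocks11 : IsConfiguration 19 blocks11 := by decide +kernel

/-- The polytope of the states of `blocks11`. -/
abbrev polytope11 : Set (ℝ × ℝ × ℝ) :=
  {p | 0 ≤ p.1 ∧ p.1 ≤ 2 / 3 ∧ 0 ≤ p.2.1 ∧ p.2.1 ≤ 2 / 3 ∧ 0 ≤ p.2.2 ∧ p.2.2 ≤ 2 / 3 ∧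
    1 / 3 ≤ p.1 + p.2.1 ∧ p.1 - 1 / 3 ≤ p.2.2 ∧ p.2.1 + p.2.2 ≤ 1}

/-- The vertices of `polytope11`. -/
abbrev vertices11 : Set (ℝ × ℝ × ℝ) :=
  {(1 / 3, 0, 0), (0, 1 / 3, 0), (0, 2 / 3, 0), (1 / 3, 2 / 3, 0),
      (2 / 3, 2 / 3, 1 / 3), (2 / 3, 0, 1 / 3), (0, 2 / 3, 1 / 3), (1 / 3, 0, 2 / 3),
      (2 / 3, 0, 2 / 3), (2 / 3, 1 / 3, 2 / 3), (0, 1 / 3, 2 / 3)}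

/-- The weights of `blocks11` in terms of the coordinates. -/
noncomputable def weight11 (x y z : ℝ) : List ℝ :=
  [x + y - 1 / 3, 2 / 3 - x, 2 / 3 - y, 2 / 3 - x, 2 / 3 - y, 1 / 3 + z - x, 1 - y - z, x,
    1 / 3, x, 1 / 3, 1 / 3, y, 1 / 3, y, 2 / 3 - z, 2 / 3 - z, z, z]

theorem bijOn_weights_blocks11 :
    BijOn (fun w : ℕ → ℝ => (w 10, w 15, w 19)) (weights 19 blocks11) polytope11 := by
  refine bijOn_weights_of_section (f := fun p => weight11 p.1 p.2.1 p.2.2)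
    (fun _ => rfl) ?_ ?_
  · rintro w ⟨hw0, -, hw1⟩
    simp [blocks11, commonBlocks] at hw1
    have hw : ∀ i ∈ Finset.Icc 1 19, w i = listWeight (weight11 (w 10) (w 15) (w 19)) i := by
      intro i hi
      rw [Finset.mem_Icc] at hi
      obtain ⟨hi1, hi2⟩ := hi
      interval_cases i <;>
        simp only [weight11, listWeight, List.getD_cons_succ, List.getD_cons_zero] <;>
        linarith
    refine ⟨hw, ?_⟩
    have h := fun i hi => (hw0 i hi).trans_eq (hw i hi)
    simp only [weight11, listWeight] at h
    -- The nonnegativity of these values cuts out the polytope.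
    have h1 := h 1 (by decide)
    have h2 := h 2 (by decide)
    have h3 := h 3 (by decide)
    have h6 := h 6 (by decide)
    have h7 := h 7 (by decide)
    have h8 := h 8 (by decide)
    have h13 := h 13 (by decide)
    have h16 := h 16 (by decide)
    have h18 := h 18 (by decide)
    simp only [List.getD_cons_succ, List.getD_cons_zero] at h1 h2 h3 h6 h7 h8 h13 h16 h18
    refine ⟨?_, ?_, ?_, ?_, ?_, ?_, ?_, ?_, ?_⟩ <;> linarith
  · rintro ⟨x, y, z⟩ hp
    simp only [mem_ofPred_eq] at hp
    obtain ⟨h1, h2, h3, h4, h5, h6, h7, h8, h9⟩ := hp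
    refine ⟨?_, ?_, rfl⟩
    · simp only [weight11, List.forall_mem_cons, List.not_mem_nil, IsEmpty.forall_iff, implies_true,
        and_true]
      and_intros <;> linarith
    · simp [blocks11, commonBlocks, weight11, listWeight]
      and_intros <;> ring

theorem polytope11_subset_convexHull : polytope11 ⊆ convexHull ℝ vertices11 := by
  rintro ⟨x, y, z⟩ hp
  simp only [mem_ofPred_eq] at hp
  obtain ⟨h1, h2, h3, h4, h5, h6, h7, h8, h9⟩ := hp
  rcases le_total (1 + 3 * y) (3 * x + 3 * z) with h | h
  · rcases le_total (6 * x + 12 * y) (2 + 3 * z) with h | h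
    · exact mem_convexHull_of_weights
        ![(0, 1 / 3, 2 / 3), (1 / 3, 0, 0), (1 / 3, 0, 2 / 3), (2 / 3, 0, 2 / 3)]
        ![3 * y, 1 - 3 / 2 * z, 1 + 3 / 2 * z - 3 * x - 6 * y, 3 * x + 3 * y - 1]
    · rcases le_total (12 * x) (4 + 3 * y + 6 * z) with h | h
      · rcases le_total 10 (3 * x + 6 * y + 12 * z) with h | h
        · exact mem_convexHull_of_weights
            ![(0, 1 / 3, 2 / 3), (2 / 3, 0, 2 / 3), (2 / 3, 1 / 3, 2 / 3),
              (2 / 3, 2 / 3, 1 / 3)]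
            ![1 - 3 / 2 * x, 3 - 3 * y - 3 * z, 3 / 2 * x + 3 * y + 6 * z - 5, 2 - 3 * z]
        · exact mem_convexHull_of_weights
            ![(0, 1 / 3, 2 / 3), (1 / 3, 0, 0), (2 / 3, 0, 2 / 3), (2 / 3, 2 / 3, 1 / 3)]
            ![4 / 9 + 1 / 3 * y + 2 / 3 * z - 4 / 3 * x,
              10 / 9 - 1 / 3 * x - 2 / 3 * y - 4 / 3 * z, x + z - 1 / 3 - y,
              2 / 3 * x + 4 / 3 * y - 2 / 9 - 1 / 3 * z]
      · exact mem_convexHull_of_weights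
          ![(1 / 3, 0, 0), (2 / 3, 0, 1 / 3), (2 / 3, 0, 2 / 3), (2 / 3, 2 / 3, 1 / 3)]
          ![2 - 3 * x, 6 * x - 2 - 3 / 2 * y - 3 * z, 1 + 3 * z - 3 * x, 3 / 2 * y]
  · rcases le_total (6 * x + 3 * y) (2 + 12 * z) with h | h
    · rcases le_total 4 (12 * x + 6 * y + 3 * z) with h | h
      · rcases le_total (8 + 3 * x) (12 * y + 6 * z) with h | h
        · exact mem_convexHull_of_weights
            ![(0, 1 / 3, 2 / 3), (0, 2 / 3, 0), (0, 2 / 3, 1 / 3), (2 / 3, 2 / 3, 1 / 3)]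
            ![2 - 3 * y, 3 - 3 * y - 3 * z, 6 * y + 3 * z - 4 - 3 / 2 * x, 3 / 2 * x]
        · exact mem_convexHull_of_weights
            ![(0, 1 / 3, 2 / 3), (0, 2 / 3, 0), (1 / 3, 0, 0), (2 / 3, 2 / 3, 1 / 3)]
            ![2 / 9 + 4 / 3 * z - 2 / 3 * x - 1 / 3 * y, 1 / 3 + y - x - z,
              8 / 9 + 1 / 3 * x - 4 / 3 * y - 2 / 3 * z,
              4 / 3 * x + 2 / 3 * y + 1 / 3 * z - 4 / 9]
      · exact mem_convexHull_of_weights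
          ![(0, 1 / 3, 0), (0, 1 / 3, 2 / 3), (0, 2 / 3, 0), (1 / 3, 0, 0)]
          ![2 - 6 * x - 3 * y - 3 / 2 * z, 3 / 2 * z, 3 * x + 3 * y - 1, 3 * x]
    · exact mem_convexHull_of_weights
        ![(0, 2 / 3, 0), (1 / 3, 0, 0), (1 / 3, 2 / 3, 0), (2 / 3, 2 / 3, 1 / 3)]
        ![1 + 3 * z - 3 * x, 1 - 3 / 2 * y, 3 * x + 3 / 2 * y - 1 - 6 * z, 3 * z]

theorem eq_zero_of_mem_vertices11 :
    ∀ v ∈ vertices11, ∀ d, v + d ∈ polytope11 → v - d ∈ polytope11 → d = 0 := by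
  rintro _ (rfl | rfl | rfl | rfl | rfl | rfl | rfl | rfl | rfl | rfl | rfl) ⟨a, b, c⟩ hp hq
  all_goals
    simp only [mem_ofPred_eq, Prod.mk_add_mk, Prod.mk_sub_mk, Prod.mk_eq_zero] at hp hq ⊢
    obtain ⟨p1, p2, p3, p4, p5, p6, p7, p8, p9⟩ := hp
    obtain ⟨q1, q2, q3, q4, q5, q6, q7, q8, q9⟩ := hq
    refine ⟨?_, ?_, ?_⟩ <;> linarith

theorem extremePoints_polytope11 : polytope11.extremePoints ℝ = vertices11 :=
  extremePoints_eq_of_subset_convexHull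
    (convex_of_bijOn bijOn_weights_blocks11 ⟨fun _ _ => rfl, fun _ _ => rfl⟩ (convex_weights _ _))
    (by rintro _ (rfl | rfl | rfl | rfl | rfl | rfl | rfl | rfl | rfl | rfl | rfl) <;> norm_num)
    polytope11_subset_convexHull eq_zero_of_mem_vertices11

theorem encard_vertices11 : vertices11.encard = 11 := by
  repeat rw [encard_insert_of_notMem (by norm_num)]
  rw [encard_singleton]
  norm_num

end OrthomodularPoset

theorem theorem2p2 :
    -- existence for every listed number `k` of pure states
    (∀ k ∈ ({1, 2, 3, 4, 5, 6, 7, 10, 11} : Set ℕ), ∃ (L : Type) (_ : OrthomodularPoset L),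
      Finite L ∧ OrthomodularPoset.IsHomogeneous 3 3 L ∧
      (OrthomodularPoset.atoms L).encard ≤ 19 ∧
      (OrthomodularPoset.pureStates L).encard = k) ∧
    -- the explicit examples: block list, state space as a polytope in coordinates, its vertices
    (∃ (L : Type) (_ : OrthomodularPoset L) (a : ℕ → L),
      OrthomodularPoset.HasBlockList 19 OrthomodularPoset.blocks1 a ∧
      OrthomodularPoset.IsHomogeneous 3 3 L ∧
      (∀ s ∈ OrthomodularPoset.stateSpace L, ∀ i ∈ Set.Icc 1 19, s (a i) = 1 / 3) ∧
      (OrthomodularPoset.pureStates L).encard = 1) ∧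
    (∃ (L : Type) (_ : OrthomodularPoset L) (a : ℕ → L),
      OrthomodularPoset.HasBlockList 17 OrthomodularPoset.blocks2 a ∧
      OrthomodularPoset.IsHomogeneous 3 3 L ∧
      Set.BijOn (fun s : L → ℝ => s (a 1)) (OrthomodularPoset.stateSpace L)
        ({x | 0 ≤ x ∧ x ≤ 2 / 3} : Set (ℝ)) ∧
      (fun s : L → ℝ => s (a 1)) '' OrthomodularPoset.pureStates L =
        ({0, 2 / 3} : Set (ℝ)) ∧
      (OrthomodularPoset.pureStates L).encard = 2) ∧
    (∃ (L : Type) (_ : OrthomodularPoset L) (a : ℕ → L),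
      OrthomodularPoset.HasBlockList 18 OrthomodularPoset.blocks3 a ∧
      OrthomodularPoset.IsHomogeneous 3 3 L ∧
      Set.BijOn (fun s : L → ℝ => (s (a 17), s (a 18))) (OrthomodularPoset.stateSpace L)
        ({(x, y) | 0 ≤ x ∧ x ≤ 1 ∧ 0 ≤ y ∧ y ≤ 1 ∧ x + y ≤ 1} : Set (ℝ × ℝ)) ∧
      (fun s : L → ℝ => (s (a 17), s (a 18))) '' OrthomodularPoset.pureStates L =
        ({(0, 0), (1, 0), (0, 1)} : Set (ℝ × ℝ)) ∧
      (OrthomodularPoset.pureStates L).encard = 3) ∧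
    (∃ (L : Type) (_ : OrthomodularPoset L) (a : ℕ → L),
      OrthomodularPoset.HasBlockList 19 OrthomodularPoset.blocks4 a ∧
      OrthomodularPoset.IsHomogeneous 3 3 L ∧
      Set.BijOn (fun s : L → ℝ => (s (a 6), s (a 8))) (OrthomodularPoset.stateSpace L)
        ({(x, y) | 0 ≤ x ∧ x ≤ 2 / 3 ∧ 1 / 6 ≤ y ∧ y ≤ 1 / 2 ∧ 1 / 2 ≤ x + y ∧ x + y ≤ 5 / 6} : Set (ℝ × ℝ)) ∧
      (fun s : L → ℝ => (s (a 6), s (a 8))) '' OrthomodularPoset.pureStates L =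
        ({(0, 1 / 2), (1 / 3, 1 / 6), (2 / 3, 1 / 6), (1 / 3, 1 / 2)} : Set (ℝ × ℝ)) ∧
      (OrthomodularPoset.pureStates L).encard = 4) ∧
    (∃ (L : Type) (_ : OrthomodularPoset L) (a : ℕ → L),
      OrthomodularPoset.HasBlockList 19 OrthomodularPoset.blocks5 a ∧
      OrthomodularPoset.IsHomogeneous 3 3 L ∧
      Set.BijOn (fun s : L → ℝ => (s (a 15), s (a 19))) (OrthomodularPoset.stateSpace L)
        ({(x, y) | 0 ≤ x ∧ x ≤ 2 / 3 ∧ 0 ≤ y ∧ y ≤ 2 / 3 ∧ x - y ≤ 1 / 3} : Set (ℝ × ℝ)) ∧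
      (fun s : L → ℝ => (s (a 15), s (a 19))) '' OrthomodularPoset.pureStates L =
        ({(0, 0), (0, 2 / 3), (1 / 3, 0), (2 / 3, 1 / 3), (2 / 3, 2 / 3)} : Set (ℝ × ℝ)) ∧
      (OrthomodularPoset.pureStates L).encard = 5) ∧
    (∃ (L : Type) (_ : OrthomodularPoset L) (a : ℕ → L),
      OrthomodularPoset.HasBlockList 19 OrthomodularPoset.blocks6 a ∧
      OrthomodularPoset.IsHomogeneous 3 3 L ∧
      Set.BijOn (fun s : L → ℝ => (s (a 2), s (a 10))) (OrthomodularPoset.stateSpace L)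
        ({(x, y) | 0 ≤ x ∧ x ≤ 2 / 3 ∧ 1 / 6 ≤ y ∧ y ≤ 1 / 2 ∧ y + x ≤ 1 ∧ y - x ≤ 1 / 3} : Set (ℝ × ℝ)) ∧
      (fun s : L → ℝ => (s (a 2), s (a 10))) '' OrthomodularPoset.pureStates L =
        ({(0, 1 / 6), (0, 1 / 3), (1 / 6, 1 / 2), (1 / 2, 1 / 2), (2 / 3, 1 / 3),
          (2 / 3, 1 / 6)} : Set (ℝ × ℝ)) ∧
      (OrthomodularPoset.pureStates L).encard = 6) ∧
    (∃ (L : Type) (_ : OrthomodularPoset L) (a : ℕ → L),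
      OrthomodularPoset.HasBlockList 18 OrthomodularPoset.blocks7 a ∧
      OrthomodularPoset.IsHomogeneous 3 3 L ∧
      Set.BijOn (fun s : L → ℝ => (s (a 1), s (a 3), s (a 18))) (OrthomodularPoset.stateSpace L)
        ({(x, y, z) | 0 ≤ x ∧ x ≤ 1 ∧ 0 ≤ y ∧ y ≤ 1 ∧ 0 ≤ z ∧ z ≤ 1 / 2 ∧
          x + y ≤ 1 ∧ x + z ≤ 1 ∧ y + z ≤ 1} : Set (ℝ × ℝ × ℝ)) ∧
      (fun s : L → ℝ => (s (a 1), s (a 3), s (a 18))) '' OrthomodularPoset.pureStates L =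
        ({(0, 0, 0), (0, 1, 0), (1, 0, 0), (0, 0, 1 / 2), (0, 1 / 2, 1 / 2),
          (1 / 2, 0, 1 / 2), (1 / 2, 1 / 2, 1 / 2)} : Set (ℝ × ℝ × ℝ)) ∧
      (OrthomodularPoset.pureStates L).encard = 7) ∧
    (∃ (L : Type) (_ : OrthomodularPoset L) (a : ℕ → L),
      OrthomodularPoset.HasBlockList 18 OrthomodularPoset.blocks10 a ∧
      OrthomodularPoset.IsHomogeneous 3 3 L ∧
      Set.BijOn (fun s : L → ℝ => (s (a 1), s (a 2), s (a 8), s (a 10))) (OrthomodularPoset.stateSpace L)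
        ({(x, y, z, w) | 0 ≤ x ∧ 0 ≤ y ∧ 0 ≤ z ∧ 0 ≤ w ∧ x + y ≤ 1 ∧ y + z ≤ 1 ∧ y + w ≤ 1 ∧
          z + w ≤ 1 ∧ z ≤ x + y ∧ w ≤ x + y} : Set (ℝ × ℝ × ℝ × ℝ)) ∧
      (fun s : L → ℝ => (s (a 1), s (a 2), s (a 8), s (a 10))) '' OrthomodularPoset.pureStates L =
        ({(0, 0, 0, 0), (0, 1, 0, 0), (1, 0, 0, 0), (1, 0, 1, 0),
          (1, 0, 0, 1), (0, 1 / 2, 1 / 2, 0), (0, 1 / 2, 0, 1 / 2), (0, 1 / 2, 1 / 2, 1 / 2),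
          (1 / 2, 0, 1 / 2, 1 / 2), (1 / 2, 1 / 2, 1 / 2, 1 / 2)} : Set (ℝ × ℝ × ℝ × ℝ)) ∧
      (OrthomodularPoset.pureStates L).encard = 10) ∧
    (∃ (L : Type) (_ : OrthomodularPoset L) (a : ℕ → L),
      OrthomodularPoset.HasBlockList 19 OrthomodularPoset.blocks11 a ∧
      OrthomodularPoset.IsHomogeneous 3 3 L ∧
      Set.BijOn (fun s : L → ℝ => (s (a 10), s (a 15), s (a 19))) (OrthomodularPoset.stateSpace L)
        ({(x, y, z) | 0 ≤ x ∧ x ≤ 2 / 3 ∧ 0 ≤ y ∧ y ≤ 2 / 3 ∧ 0 ≤ z ∧ z ≤ 2 / 3 ∧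
          1 / 3 ≤ x + y ∧ x - 1 / 3 ≤ z ∧ y + z ≤ 1} : Set (ℝ × ℝ × ℝ)) ∧
      (fun s : L → ℝ => (s (a 10), s (a 15), s (a 19))) '' OrthomodularPoset.pureStates L =
        ({(1 / 3, 0, 0), (0, 1 / 3, 0), (0, 2 / 3, 0), (1 / 3, 2 / 3, 0),
          (2 / 3, 2 / 3, 1 / 3), (2 / 3, 0, 1 / 3), (0, 2 / 3, 1 / 3), (1 / 3, 0, 2 / 3),
          (2 / 3, 0, 2 / 3), (2 / 3, 1 / 3, 2 / 3), (0, 1 / 3, 2 / 3)} : Set (ℝ × ℝ × ℝ)) ∧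
      (OrthomodularPoset.pureStates L).encard = 11) := by
  -- For the first list the function of all values on the atoms serves as the coordinate.
  have H1 := OrthomodularPoset.isConfiguration_blocks1.exists_logic (π := fun w => w)
    (P := {OrthomodularPoset.weight1}) ⟨fun _ _ => rfl, fun _ _ => rfl⟩
    (by rw [OrthomodularPoset.weights_blocks1]; exact Set.bijOn_id _)
    extremePoints_singleton (Set.encard_singleton _)
  have H2 := OrthomodularPoset.isConfiguration_blocks2.exists_logic
    ⟨fun _ _ => rfl, fun _ _ => rfl⟩ OrthomodularPoset.bijOn_weights_blocks2
    OrthomodularPoset.extremePoints_polytope2 OrthomodularPoset.encard_vertices2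
  have H3 := OrthomodularPoset.isConfiguration_blocks3.exists_logic
    ⟨fun _ _ => rfl, fun _ _ => rfl⟩ OrthomodularPoset.bijOn_weights_blocks3
    OrthomodularPoset.extremePoints_polytope3 OrthomodularPoset.encard_vertices3
  have H4 := OrthomodularPoset.isConfiguration_blocks4.exists_logic
    ⟨fun _ _ => rfl, fun _ _ => rfl⟩ OrthomodularPoset.bijOn_weights_blocks4
    OrthomodularPoset.extremePoints_polytope4 OrthomodularPoset.encard_vertices4
  have H5 := OrthomodularPoset.isConfiguration_blocks5.exists_logic
    ⟨fun _ _ => rfl, fun _ _ => rfl⟩ OrthomodularPoset.bijOn_weights_blocks5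
    OrthomodularPoset.extremePoints_polytope5 OrthomodularPoset.encard_vertices5
  have H6 := OrthomodularPoset.isConfiguration_blocks6.exists_logic
    ⟨fun _ _ => rfl, fun _ _ => rfl⟩ OrthomodularPoset.bijOn_weights_blocks6
    OrthomodularPoset.extremePoints_polytope6 OrthomodularPoset.encard_vertices6
  have H7 := OrthomodularPoset.isConfiguration_blocks7.exists_logic
    ⟨fun _ _ => rfl, fun _ _ => rfl⟩ OrthomodularPoset.bijOn_weights_blocks7
    OrthomodularPoset.extremePoints_polytope7 OrthomodularPoset.encard_vertices7
  have H10 := OrthomodularPoset.isConfiguration_blocks10.exists_logic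
    ⟨fun _ _ => rfl, fun _ _ => rfl⟩ OrthomodularPoset.bijOn_weights_blocks10
    OrthomodularPoset.extremePoints_polytope10 OrthomodularPoset.encard_vertices10
  have H11 := OrthomodularPoset.isConfiguration_blocks11.exists_logic
    ⟨fun _ _ => rfl, fun _ _ => rfl⟩ OrthomodularPoset.bijOn_weights_blocks11
    OrthomodularPoset.extremePoints_polytope11 OrthomodularPoset.encard_vertices11
  refine ⟨?_, ?_, H2, H3, H4, H5, H6, H7, H10, H11⟩
  · simp only [Set.mem_insert_iff, Set.mem_singleton_iff]
    rintro k (rfl | rfl | rfl | rfl | rfl | rfl | rfl | rfl | rfl)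
    · obtain ⟨L, hL, a, hB, hh, -, -, hk⟩ := H1
      exact ⟨L, hL, hB.1, hh, (OrthomodularPoset.encard_atoms hB).le.trans (by norm_num), hk⟩
    · obtain ⟨L, hL, a, hB, hh, -, -, hk⟩ := H2
      exact ⟨L, hL, hB.1, hh, (OrthomodularPoset.encard_atoms hB).le.trans (by norm_num), hk⟩
    · obtain ⟨L, hL, a, hB, hh, -, -, hk⟩ := H3
      exact ⟨L, hL, hB.1, hh, (OrthomodularPoset.encard_atoms hB).le.trans (by norm_num), hk⟩
    · obtain ⟨L, hL, a, hB, hh, -, -, hk⟩ := H4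
      exact ⟨L, hL, hB.1, hh, (OrthomodularPoset.encard_atoms hB).le.trans (by norm_num), hk⟩
    · obtain ⟨L, hL, a, hB, hh, -, -, hk⟩ := H5
      exact ⟨L, hL, hB.1, hh, (OrthomodularPoset.encard_atoms hB).le.trans (by norm_num), hk⟩
    · obtain ⟨L, hL, a, hB, hh, -, -, hk⟩ := H6
      exact ⟨L, hL, hB.1, hh, (OrthomodularPoset.encard_atoms hB).le.trans (by norm_num), hk⟩
    · obtain ⟨L, hL, a, hB, hh, -, -, hk⟩ := H7
      exact ⟨L, hL, hB.1, hh, (OrthomodularPoset.encard_atoms hB).le.trans (by norm_num), hk⟩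
    · obtain ⟨L, hL, a, hB, hh, -, -, hk⟩ := H10
      exact ⟨L, hL, hB.1, hh, (OrthomodularPoset.encard_atoms hB).le.trans (by norm_num), hk⟩
    · obtain ⟨L, hL, a, hB, hh, -, -, hk⟩ := H11
      exact ⟨L, hL, hB.1, hh, (OrthomodularPoset.encard_atoms hB).le.trans (by norm_num), hk⟩
  · obtain ⟨L, hL, a, hB, hh, hb, -, hk⟩ := H1
    refine ⟨L, hL, a, hB, hh, fun s hs i hi => ?_, hk⟩
    have hs1 : s (a i) = OrthomodularPoset.weight1 i := congrFun (hb.mapsTo hs) i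
    rw [hs1]
    exact if_pos (Finset.mem_Icc.2 hi)
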